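/- A multigraph (loops and multiple edges allowed) has labelled vertices $1,\dots,n$ and unlabelled edges; a loop contributes $2$ to the degree of its vertex. For a multigraph $M$ let $e_i(M)$ be the number of unordered pairs of distinct vertices joined by exactly $i$ edges, $\ell_i(M)$ the number of vertices with exactly $i$ loops, and $\ell(M)=\sum_i i\,\ell_i(M)$. Its weight (compensation factor) is $$w(M)=2^{-\ell(M)}\prod_{i\ge 1}(i!)^{-e_i(M)-\ell_i(M)}.$$ A multigraph is embeddable on $\mathbb S_g$, the orientable surface of genus $g$, if it can be drawn on $\mathbb S_g$ without crossing edges; in combinatorial terms, if its half-edges can be cyclically ordered around the vertices (a rotation system) so that the genera of the closed orientable surfaces obtained by gluing discs to the boundary walks of its components have sum at most $g$. The genus of a multigraph is the least $g\in\mathbb N=\{0,1,2,\dots\}$ such that it is embeddable on $\mathbb S_g$. For $g,n,m\in\mathbb N$ let $\mathcal K_g(n,m)$ be the class of multigraphs with vertex set $\{1,\dots,n\}$, exactly $m$ edges and minimum degree at least three that are embeddable on $\mathbb S_g$. For $k\in\mathbb N$ let $\mathcal K_g(n,m;\mathcal P_1)$ be the subclass of those with precisely $k$ components, and let $\mathcal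 K_g(n,m;\mathcal P_2)$ be the subclass of those which, if $g\ge1$, have every component of genus strictly smaller than $g$ (for $g=0$ this is no restriction). For each of these classes, $|\cdot|$ denotes the sum of the weights of its members. **Lemma.** Let $g,k,l,d\in\mathbb N$ with $l\ge1$ and $d\le 2l$. Then, for $i=1,2$, $$\frac{|\mathcal K_g(2l-d,3l-d)|}{|\mathcal K_g(2l,3l)|}\le\frac{6^d}{d!}\qquad\text{and}\qquad\frac{|\mathcal K_g(2l-d,3l-d;\mathcal P_i)|}{|\mathcal K_g(2l,3l;\mathcal P_i)|}\le\frac{6^d}{d!}.$$ If in addition $d\le\frac27 l$, then also, for $i=1,2$, $$\frac{|\mathcal K_g(2l-d,3l-d)|}{|\mathcal K_g(2l,3l)|}\ge\frac1{216^d\,d!}\qquad\text{and}\qquad\frac{|\mathcal K_g(2l-d,3l-d;\mathcal P_i)|}{|\mathcal K_g(2l,3l;\mathcal P_i)|}\ge\frac1{216^d\,d!}.$$ Here a bound on a quotient means the same bound multiplied by the denominator, so that it also makes sense when the denominator is $0$ (as may happen for $\mathcal P_1$, e.g. for $k=0$); in particular the numerator is then $0$ too. -/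

import Mathlib

/-- A multigraph on the vertex set `V` (loops and multiple edges allowed, edges unlabelled), given by
the number of edges joining each unordered pair of vertices: `M s(u, v)` is the number of edges
between `u` and `v`, and `M s(v, v)` is the number of loops at `v`. -/
abbrev Multigraph (V : Type*) := Sym2 V → ℕ

namespace Multigraph

variable {V : Type*}

/-- The degree of a vertex; every loop contributes two. -/
def degree [Fintype V] (M : Multigraph V) (v : V) : ℕ :=
  (∑ u, M s(v, u)) + M s(v, v)

/-- The compensation factor `2 ^ (-ℓ(M)) * ∏_{i ≥ 1} (i!) ^ (-e_i(M) - ℓ_i(M))`. Grouping the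
unordered pairs (loops included) by their multiplicity `i`, the product is that of
`1 / (multiplicity)!` over all unordered pairs of vertices. -/
noncomputable def compensationFactor [Fintype V] [DecidableEq V] (M : Multigraph V) : ℝ :=
  ((2 : ℝ) ^ (∑ v, M s(v, v)))⁻¹ * ∏ e : Sym2 V, ((M e).factorial : ℝ)⁻¹

/-- The simple graph underlying a multigraph; it has the same connected components. -/
def toSimple (M : Multigraph V) : SimpleGraph V :=
  SimpleGraph.fromEdgeSet {e | M e ≠ 0}

/-- The number of connected components. -/
noncomputable def numComponents (M : Multigraph V) : ℕ :=
  Nat.card M.toSimple.ConnectedComponent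

/-- The sub-multigraph induced by a set of vertices, as a multigraph on that set. -/
def induce (M : Multigraph V) (S : Set V) : Multigraph S :=
  fun e => M (e.map Subtype.val)

/-- A combinatorial embedding (rotation system, combinatorial map) of a multigraph: the edges are
numbered and oriented, so that the edge `i` has the two half-edges `(i, false)` and `(i, true)`, the
half-edge `h` being attached to the vertex `ends h`; and `rot` is a permutation of the half-edges
whose cycles are exactly the sets of half-edges at the non-isolated vertices, i.e. it prescribes a
cyclic order of the half-edges around each vertex. Gluing a disc to every boundary walk turns each
component of the multigraph into a map on a closed orientable surface, and every cellular embedding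
in a closed orientable surface arises so. -/
structure RotationSystem (M : Multigraph V) where
  /-- The number of edges of `M` (this is forced by `card_ends`). -/
  numEdges : ℕ
  ends : Fin numEdges × Bool → V
  card_ends : ∀ e : Sym2 V,
    Nat.card {i : Fin numEdges // s(ends (i, false), ends (i, true)) = e} = M e
  rot : Equiv.Perm (Fin numEdges × Bool)
  sameCycle_rot : ∀ a b, rot.SameCycle a b ↔ ends a = ends b

namespace RotationSystem

variable {M : Multigraph V}

/-- Interchanges the two half-edges of every edge. -/
def flip (R : RotationSystem M) : Equiv.Perm (Fin R.numEdges × Bool) :=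
  Equiv.prodCongr (Equiv.refl _) Equiv.boolNot

/-- The face-tracing permutation: go along the edge to its other end and take the next half-edge
around the vertex there. Its cycles are the boundary walks of the faces. -/
def facePerm (R : RotationSystem M) : Equiv.Perm (Fin R.numEdges × Bool) :=
  R.rot * R.flip

/-- The number of faces, summed over the surfaces carrying the components of `M`. A component that
is an isolated vertex lies on a sphere and has one face. -/
noncomputable def numFaces (R : RotationSystem M) : ℕ :=
  Nat.card (Quotient (Equiv.Perm.SameCycle.setoid R.facePerm)) +
    Nat.card {v : V // v ∉ Set.range R.ends}

end RotationSystem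

/-- `M` is embeddable on the orientable surface of genus `g`: some combinatorial embedding maps the
components of `M` to closed orientable surfaces whose genera have sum at most `g`. If a component
with `v` vertices and `e` edges gets `f` faces, its surface has genus `h` with `v - e + f = 2 - 2h`;
summing over all components, the sum of the genera is at most `g` if and only if
`|V| - |E| + |F| ≥ 2 c - 2 g`, where `c` is the number of components. -/
def EmbeddableOn (M : Multigraph V) (g : ℕ) : Prop :=
  ∃ R : RotationSystem M,
    2 * M.numComponents + R.numEdges ≤ Nat.card V + R.numFaces + 2 * g

/-- The genus: the smallest `g` such that `M` is embeddable on the orientable surface of genus `g`. -/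
noncomputable def genus (M : Multigraph V) : ℕ :=
  sInf {g | M.EmbeddableOn g}

end Multigraph

open scoped Classical in
/-- The kernels with vertex set `Fin n` (standing for `{1, …, n}`) and `m` edges that are embeddable
on the orientable surface of genus `g`: all multigraphs of minimum degree at least three with these
properties. -/
noncomputable def kernelClass (g n m : ℕ) : Finset (Multigraph (Fin n)) :=
  {M ∈ Finset.piAntidiag (Finset.univ : Finset (Sym2 (Fin n))) m |
    (∀ v, 3 ≤ M.degree v) ∧ M.EmbeddableOn g}

/-- The first property: there are precisely `k` components. -/
def HasComponents (k : ℕ) {n : ℕ} (M : Multigraph (Fin n)) : Prop :=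
  M.numComponents = k

/-- The second property: if `g ≥ 1`, then every component has genus strictly smaller than `g`. -/
def ComponentsOfSmallerGenus (g : ℕ) {n : ℕ} (M : Multigraph (Fin n)) : Prop :=
  1 ≤ g → ∀ C : M.toSimple.ConnectedComponent, (M.induce C.supp).genus < g

/-- The weighted number of kernels: the sum of the compensation factors over the class. -/
noncomputable def kernelWeight (g n m : ℕ) : ℝ :=
  ∑ M ∈ kernelClass g n m, M.compensationFactor

open scoped Classical in
/-- The weighted number of kernels that have the property `P`. -/
noncomputable def kernelWeightWith (g n m : ℕ) (P : Multigraph (Fin n) → Prop) : ℝ :=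
  ∑ M ∈ kernelClass g n m with P M, M.compensationFactor

/-! Label and orient the edges: a multigraph with m edges becomes a map `x : E × Bool → V` sending
each half-edge to its vertex. By orbit counting under relabelling and reversing edges, the
compensation factor of M is the number of maps `x` representing M divided by m! 2^m
(`compensationFactor_toMultigraph`). So each weight is a plain count of such maps over m! 2^m, and
it suffices to compare counts for (n, m) and (n+1, m+1), that is, to change the excess d = 2m - 3n
by one, and to iterate. All three classes are instances of one predicate, `Admissible`.

The bridge is contraction of a non-loop edge and its inverse, splitting a vertex along a rotation.
If both ends of the contracted edge carry further half-edges, then the components and faces stay in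
bijection while one vertex and one edge disappear. Euler characteristics are therefore unchanged,
both for the whole multigraph and for each component (`IsCollapse.totalBound_iff`,
`IsCollapse.localBound_iff`).

Upper bound. Fix for each kernel one rotation witnessing all its genus bounds
(`Admissible.exists_rotation`). A vertex of degree D can be split into two vertices of degree at
least three along D(D-3) ordered pairs of half-edges. By Cauchy-Schwarz these sum to at least 2md/n
for excess d, and the choice of a label for the new vertex supplies the missing factor n. Distinct
choices give distinct kernels, so the count grows by a factor of at least 2md
(`ncard_kernelEnds_mul_le`).

Lower bound. Work with kernels of maximum degree at most four; for excess 0 every kernel is cubic,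
so nothing is lost at the start. With excess d there are exactly d quartic vertices, so at least n -
5d half-edges lie on edges joining distinct cubic vertices. Contracting such an edge creates a
quartic vertex, and the original is recovered from the chosen half-edge, the label of its far end,
the quartic vertex and a subset of its four half-edges. This bounds the count from above by the
count for excess d + 1 (`ncard_subquarticEnds_mul_le`). -/

/-! ### Permutations: deleting a point, cutting and merging cycles. -/

namespace Equiv.Perm

theorem SameCycle.apply_eq {α β : Type*} {f : Perm α} {c : α → β} (hc : ∀ x, c (f x) = c x)
    {x y : α} (h : f.SameCycle x y) : c x = c y := by
  obtain ⟨i, rfl⟩ := h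
  induction i using Int.induction_on generalizing x with
  | zero => rfl
  | succ i ih => rw [zpow_add_one, mul_apply, ← ih, hc]
  | pred i ih =>
    rw [zpow_sub_one, mul_apply, ← ih]
    conv_lhs => rw [← f.apply_symm_apply x]
    exact hc _

theorem SameCycle.rel {α : Type*} {f : Perm α} (r : Setoid α) (hr : ∀ x, r x (f x))
    {x y : α} (h : f.SameCycle x y) : r x y :=
  Quotient.exact (h.apply_eq (c := Quotient.mk r) fun x => Quotient.sound (r.symm (hr x)))

/-- Deleting a point short-circuits its cycle and leaves the partition of the other points into
cycles intact. -/
theorem sameCycle_removeNone {α : Type*} (σ : Perm (Option α)) (s t : α) :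
    SameCycle (removeNone σ) s t ↔ σ.SameCycle (some s) (some t) := by
  constructor
  · intro h
    refine h.rel ((SameCycle.setoid σ).comap some) fun z => ?_
    change σ.SameCycle (some z) (some (removeNone σ z))
    cases hz : σ (some z) with
    | none => rw [removeNone_none σ hz, sameCycle_apply_right, ← hz, sameCycle_apply_right]
    | some w => rw [removeNone_some σ ⟨w, hz⟩, sameCycle_apply_right]
  · intro h
    let q : α → Quotient (SameCycle.setoid (removeNone σ)) := Quotient.mk _
    have hq : ∀ z, q (removeNone σ z) = q z := fun z =>
      Quotient.sound (sameCycle_apply_left.2 (SameCycle.refl (removeNone σ) z))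
    -- A colouring invariant under `σ`: `none` takes the colour of its image, or a colour of its own
    -- if `σ` fixes it.
    let c : Option α → Option (Quotient (SameCycle.setoid (removeNone σ))) :=
      fun o => o.elim ((σ none).map q) fun z => some (q z)
    have hc : ∀ o, c (σ o) = c o := by
      rintro (_ | z)
      · cases h0 : σ none with
        | none => rfl
        | some w => simp [c, h0]
      · cases hz : σ (some z) with
        | none =>
          have h1 := removeNone_none σ hz
          simp [c, ← h1, hq]
        | some w =>
          have h1 := removeNone_some σ ⟨w, hz⟩
          rw [hz] at h1
          have : w = removeNone σ z := by simpa using h1.symm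
          simp [c, this, hq]
    have := h.apply_eq hc
    exact Quotient.exact (Option.some_injective _ this)

theorem removeNone_mul_optionCongr {α : Type*} (σ : Perm (Option α)) (p : Perm α) :
    removeNone (σ * p.optionCongr) = removeNone σ * p := by
  ext z
  apply Option.some_injective
  rw [mul_apply]
  have e : (σ * p.optionCongr) (some z) = σ (some (p z)) := by simp
  cases hz : σ (some (p z)) with
  | none =>
    rw [removeNone_none _ (e.trans hz), removeNone_none _ hz]; simp
  | some w =>
    rw [removeNone_some _ ⟨w, e.trans hz⟩, removeNone_some _ ⟨w, hz⟩]; simp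

variable {α : Type*} [DecidableEq α]

theorem mul_swap_apply_left (f : Perm α) (x y : α) : (f * swap x y) x = f y := by simp

theorem mul_swap_apply_right (f : Perm α) (x y : α) : (f * swap x y) y = f x := by simp

theorem mul_swap_apply_of_ne {f : Perm α} {x y z : α} (hx : z ≠ x) (hy : z ≠ y) :
    (f * swap x y) z = f z := by simp [swap_apply_of_ne_of_ne hx hy]

theorem mul_swap_mul_swap (f : Perm α) (x y : α) : f * swap x y * swap x y = f := by
  simp [mul_assoc]

/-- Multiplying by the transposition of two points of the same cycle separates them. -/
theorem not_sameCycle_mul_swap [Finite α] {f : Perm α} {x y : α} (hxy : x ≠ y)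
    (h : f.SameCycle x y) : ¬ (f * swap x y).SameCycle x y := by
  obtain ⟨j, hj, hJ⟩ : ∃ j : ℕ, 0 < j ∧ (f ^ j) y = x := by
    obtain ⟨j, hj, -, h⟩ := h.symm.exists_pow_eq''
    exact ⟨j, hj, h⟩
  classical
  have hex : ∃ j : ℕ, 0 < j ∧ (f ^ j) y = x := ⟨j, hj, hJ⟩
  set J := Nat.find hex with hJdef
  obtain ⟨hJ0, hJ⟩ : 0 < J ∧ (f ^ J) y = x := Nat.find_spec hex
  have hmin : ∀ i, 0 < i → i < J → (f ^ i) y ≠ x := fun i hi hiJ he =>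
    Nat.find_min hex hiJ ⟨hi, he⟩
  have hy : ∀ i, 0 < i → i ≤ J → (f ^ i) y ≠ y := by
    intro i hi hiJ he
    rcases hiJ.eq_or_lt with rfl | hlt
    · exact hxy (hJ.symm.trans he)
    · refine hmin (J - i) (by omega) (by omega) ?_
      have : (f ^ (J - i)) ((f ^ i) y) = x := by
        rw [← mul_apply, ← pow_add, Nat.sub_add_cancel hiJ, hJ]
      rwa [he] at this
  -- The arc f y, …, f^J y = x is stable under `f * swap x y`, because x is now sent to f y. It
  -- contains x and avoids y.
  have hmem : ∀ z, (∃ i, 0 < i ∧ i ≤ J ∧ (f ^ i) y = z) →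
      ∃ i, 0 < i ∧ i ≤ J ∧ (f ^ i) y = (f * swap x y) z := by
    rintro z ⟨i, hi, hiJ, rfl⟩
    rcases hiJ.eq_or_lt with rfl | hlt
    · refine ⟨1, one_pos, hi, ?_⟩
      rw [hJ, mul_swap_apply_left, pow_one]
    · refine ⟨i + 1, by omega, hlt, ?_⟩
      rw [mul_swap_apply_of_ne (hmin i hi hlt) (hy i hi hiJ), pow_succ', mul_apply]
  intro hs
  obtain ⟨n, hn⟩ := hs.exists_nat_pow_eq
  have key : ∀ n : ℕ, ∃ i, 0 < i ∧ i ≤ J ∧ (f ^ i) y = ((f * swap x y) ^ n) x := by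
    intro n
    induction n with
    | zero => exact ⟨J, hJ0, le_rfl, hJ⟩
    | succ n ih =>
      rw [pow_succ', mul_apply]
      exact hmem _ ih
  obtain ⟨i, hi, hiJ, he⟩ := key n
  exact hy i hi hiJ (he.trans hn)

/-- From y the product jumps to g x and then follows the g-cycle of x until it closes at x, never
meeting y on the way. -/
theorem sameCycle_mul_swap_of_not [Finite α] {g : Perm α} {x y : α}
    (h : ¬ g.SameCycle x y) : (g * swap x y).SameCycle x y := by
  classical
  have hex : ∃ j : ℕ, 0 < j ∧ (g ^ j) x = x := ⟨orderOf g, orderOf_pos g, by simp [pow_orderOf_eq_one]⟩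
  set J := Nat.find hex with hJdef
  obtain ⟨hJ0, hJ⟩ : 0 < J ∧ (g ^ J) x = x := Nat.find_spec hex
  have hmin : ∀ i, 0 < i → i < J → (g ^ i) x ≠ x := fun i hi hiJ he =>
    Nat.find_min hex hiJ ⟨hi, he⟩
  have key : ∀ i : ℕ, 0 < i → i ≤ J → ((g * swap x y) ^ i) y = (g ^ i) x := by
    intro i hi
    induction i, hi using Nat.le_induction with
    | base => intro _; simp
    | succ i hi ih =>
      intro hiJ
      rw [pow_succ', mul_apply, ih (by omega), mul_swap_apply_of_ne (hmin i hi (by omega)),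
        pow_succ', mul_apply]
      intro he
      exact h ⟨i, by simpa using he⟩
  refine SameCycle.symm ⟨J, ?_⟩
  rw [zpow_natCast, key J hJ0 le_rfl, hJ]

/-- Multiplying by the transposition of points of two cycles merges these two cycles. -/
theorem sameCycle_mul_swap_iff [Finite α] {g : Perm α} {x y : α} (h : ¬ g.SameCycle x y)
    (s t : α) : (g * swap x y).SameCycle s t ↔ g.SameCycle s t ∨
      ((g.SameCycle x s ∨ g.SameCycle y s) ∧ (g.SameCycle x t ∨ g.SameCycle y t)) := by
  have hxy := sameCycle_mul_swap_of_not h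
  have hstep : ∀ {s t}, g.SameCycle s t → (g * swap x y).SameCycle s t := by
    intro s t hst
    refine hst.rel (SameCycle.setoid _) fun z => ?_
    change (g * swap x y).SameCycle z (g z)
    rcases eq_or_ne z x with rfl | hx
    · refine hxy.trans ?_
      rw [← mul_swap_apply_right g z y, sameCycle_apply_right]
    rcases eq_or_ne z y with rfl | hy
    · refine hxy.symm.trans ?_
      rw [← mul_swap_apply_left g x z, sameCycle_apply_right]
    · rw [← mul_swap_apply_of_ne hx hy, sameCycle_apply_right]
  constructor
  · intro hst
    let r : Setoid α :=
      { r := fun s t => g.SameCycle s t ∨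
          ((g.SameCycle x s ∨ g.SameCycle y s) ∧ (g.SameCycle x t ∨ g.SameCycle y t))
        iseqv := by
          refine ⟨fun s => Or.inl (SameCycle.refl _ _), ?_, ?_⟩
          · rintro s t (h | ⟨h1, h2⟩)
            · exact Or.inl h.symm
            · exact Or.inr ⟨h2, h1⟩
          · rintro s t u (h | ⟨h1, h2⟩) (h' | ⟨h1', h2'⟩)
            · exact Or.inl (h.trans h')
            · exact Or.inr ⟨h1'.imp (·.trans h.symm) (·.trans h.symm), h2'⟩
            · exact Or.inr ⟨h1, h2.imp (·.trans h') (·.trans h')⟩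
            · exact Or.inr ⟨h1, h2'⟩ }
    refine hst.rel r fun z => ?_
    rcases eq_or_ne z x with rfl | hx
    · rw [mul_swap_apply_left]
      exact Or.inr ⟨Or.inl (SameCycle.refl _ _), Or.inr (sameCycle_apply_right.2 (SameCycle.refl _ _))⟩
    rcases eq_or_ne z y with rfl | hy
    · rw [mul_swap_apply_right]
      exact Or.inr ⟨Or.inr (SameCycle.refl _ _), Or.inl (sameCycle_apply_right.2 (SameCycle.refl _ _))⟩
    · rw [mul_swap_apply_of_ne hx hy]
      exact Or.inl (sameCycle_apply_right.2 (SameCycle.refl _ _))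
  · rintro (h | ⟨h1 | h1, h2 | h2⟩)
    · exact hstep h
    · exact hstep (h1.symm.trans h2)
    · exact (hstep h1).symm.trans (hxy.trans (hstep h2))
    · exact (hstep h1).symm.trans (hxy.symm.trans (hstep h2))
    · exact hstep (h1.symm.trans h2)

end Equiv.Perm

/-! ### Half-edges, rotations, faces and components. -/

namespace HalfEdge

open Equiv Equiv.Perm

/-- The involution interchanging the two half-edges of every edge. -/
def edgeFlip (E : Type*) : Perm (E × Bool) := Equiv.prodCongr (Equiv.refl E) Equiv.boolNot

@[simp] theorem edgeFlip_apply {E : Type*} (e : E) (b : Bool) : edgeFlip E (e, b) = (e, !b) := rfl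

/-- The cycles of `ρ` are the fibres of `x`. -/
def IsRotation {E V : Type*} (x : E × Bool → V) (ρ : Perm (E × Bool)) : Prop :=
  ∀ s t, ρ.SameCycle s t ↔ x s = x t

/-- The boundary walks of the faces. -/
def faces {E : Type*} (ρ : Perm (E × Bool)) : Setoid (E × Bool) :=
  SameCycle.setoid (ρ * edgeFlip E)

/-- Half-edges are linked when they belong to the same connected component. -/
def linked {E V : Type*} (x : E × Bool → V) : Setoid (E × Bool) :=
  Relation.EqvGen.setoid fun s t => x s = x t ∨ edgeFlip E s = t

/-- The number of classes of `r` that meet `S`. -/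
noncomputable def classCount {α : Type*} (r : Setoid α) (S : Set α) : ℕ :=
  (Quotient.mk r '' S).ncard

theorem classCount_univ {α : Type*} (r : Setoid α) :
    classCount r Set.univ = Nat.card (Quotient r) := by
  rw [classCount, Set.image_univ, Set.range_eq_univ.2 Quotient.mk_surjective, Set.ncard_univ]

theorem classCount_eq_of_map {α β : Type*} {r : Setoid α} {r' : Setoid β} {S : Set α} {S' : Set β}
    (f : α → β) (hf : ∀ s t, r s t ↔ r' (f s) (f t)) (hS : Set.MapsTo f S S')
    (hS' : ∀ b ∈ S', ∃ a ∈ S, r' (f a) b) : classCount r S = classCount r' S' := by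
  let F : Quotient r → Quotient r' := Quotient.map f fun s t h => (hf s t).1 h
  have hF : F.Injective := by
    rintro ⟨s⟩ ⟨t⟩ h
    exact Quotient.sound ((hf s t).2 (Quotient.exact h))
  rw [classCount, classCount, ← Set.ncard_image_of_injective _ hF]
  congr 1
  ext q
  constructor
  · rintro ⟨_, ⟨a, ha, rfl⟩, rfl⟩
    exact ⟨f a, hS ha, rfl⟩
  · rintro ⟨b, hb, rfl⟩
    obtain ⟨a, ha, hab⟩ := hS' b hb
    exact ⟨_, ⟨a, ha, rfl⟩, Quotient.sound hab⟩

theorem card_quotient_eq_of_map {α β : Type*} {r : Setoid α} {r' : Setoid β}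
    (f : α → β) (hf : ∀ s t, r s t ↔ r' (f s) (f t)) (hf' : ∀ b, ∃ a, r' (f a) b) :
    Nat.card (Quotient r) = Nat.card (Quotient r') := by
  rw [← classCount_univ, ← classCount_univ]
  exact classCount_eq_of_map f hf (fun _ _ => trivial) fun b _ => by simpa using hf' b

section Linked

variable {E V : Type*} {x : E × Bool → V}

theorem linked_of_eq {s t : E × Bool} (h : x s = x t) : linked x s t :=
  Relation.EqvGen.rel _ _ (Or.inl h)

theorem linked_flip (s : E × Bool) : linked x s (edgeFlip E s) :=
  Relation.EqvGen.rel _ _ (Or.inr rfl)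

theorem linked_le {r : Setoid (E × Bool)} (h1 : ∀ s t, x s = x t → r s t)
    (h2 : ∀ s, r s (edgeFlip E s)) {s t : E × Bool} (h : linked x s t) : r s t := by
  induction h with
  | rel s t h =>
    rcases h with h | rfl
    · exact h1 s t h
    · exact h2 s
  | refl s => exact r.refl s
  | symm s t _ ih => exact r.symm ih
  | trans s t u _ _ ih1 ih2 => exact r.trans ih1 ih2

theorem IsRotation.linked_of_faces {ρ : Perm (E × Bool)} (hρ : IsRotation x ρ) {s t : E × Bool}
    (h : faces ρ s t) : linked x s t := by
  refine SameCycle.rel (linked x) (fun z => ?_) h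
  refine (linked x).trans (linked_flip z) (linked_of_eq ?_)
  rw [← hρ, Perm.mul_apply, sameCycle_apply_right]

end Linked

/-- The Euler characteristic inequality for the whole surface. -/
def TotalBound {E V : Type*} (g : ℕ) (x : E × Bool → V) (ρ : Perm (E × Bool)) : Prop :=
  2 * Nat.card (Quotient (linked x)) + Nat.card E ≤
    Nat.card V + Nat.card (Quotient (faces ρ)) + 2 * g

/-- The Euler characteristic inequality for the component containing the half-edge `h`. -/
def LocalBound {E V : Type*} (g : ℕ) (x : E × Bool → V) (ρ : Perm (E × Bool)) (h : E × Bool) :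
    Prop :=
  2 + {e : E | linked x (e, false) h}.ncard ≤
    (x '' {s | linked x s h}).ncard + classCount (faces ρ) {s | linked x s h} + 2 * g

/-! ### Contracting an edge and splitting a vertex, on the level of rotations. -/

section Collapse

variable {E V : Type*}

/-- The half-edges of `E` as half-edges of `Option E`. -/
def lift (s : E × Bool) : Option E × Bool := (some s.1, s.2)

@[simp] theorem lift_mk (e : E) (b : Bool) : lift (e, b) = (some e, b) := rfl

theorem lift_injective : (lift : E × Bool → Option E × Bool).Injective := by
  rintro ⟨e, b⟩ ⟨e', b'⟩ h
  simpa [lift] using h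

theorem cases_halfEdge (s : Option E × Bool) :
    s = (none, false) ∨ s = (none, true) ∨ ∃ t, s = lift t := by
  rcases s with ⟨_ | e, b⟩
  · cases b <;> simp
  · exact Or.inr (Or.inr ⟨(e, b), rfl⟩)

/-- The last edge of `y` is not a loop, its second end is the last vertex, and contracting it into
its first end yields `x`. -/
def IsCollapse (y : Option E × Bool → Option V) (x : E × Bool → V) : Prop :=
  y (none, true) = none ∧ ∃ u, y (none, false) = some u ∧ ∀ s, x s = (y (lift s)).getD u

/-- Singles out the two half-edges of the last edge. -/
def halfEdgeEquiv (E : Type*) : Option E × Bool ≃ Option (Option (E × Bool)) where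
  toFun s := match s with
    | (none, true) => none
    | (none, false) => some none
    | (some e, b) => some (some (e, b))
  invFun s := match s with
    | none => (none, true)
    | some none => (none, false)
    | some (some s) => lift s
  left_inv := by rintro ⟨_ | e, _ | _⟩ <;> rfl
  right_inv := by rintro (_ | _ | s) <;> rfl

@[simp] theorem halfEdgeEquiv_lift (s : E × Bool) : halfEdgeEquiv E (lift s) = some (some s) := rfl

theorem sameCycle_permCongr {α β : Type*} (e : α ≃ β) (f : Perm α) (s t : α) :
    SameCycle (e.permCongr f) (e s) (e t) ↔ f.SameCycle s t := by
  constructor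
  · intro h
    have := h.rel ((SameCycle.setoid f).comap e.symm) fun z => by
      change f.SameCycle _ _
      rw [Equiv.permCongr_apply, e.symm_apply_apply, sameCycle_apply_right]
    change f.SameCycle _ _ at this
    simpa using this
  · intro h
    refine h.rel ((SameCycle.setoid (e.permCongr f)).comap e) fun z => ?_
    change SameCycle (e.permCongr f) _ _
    have : e (f z) = e.permCongr f (e z) := by simp
    rw [this, sameCycle_apply_right]

variable [DecidableEq E]

/-- The rotation induced by contracting the last edge. -/
def collapsePerm (ρ' : Perm (Option E × Bool)) : Perm (E × Bool) :=
  removeNone (removeNone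
    ((halfEdgeEquiv E).permCongr (ρ' * swap (none, false) (none, true))))

theorem sameCycle_collapsePerm (ρ' : Perm (Option E × Bool)) (s t : E × Bool) :
    (collapsePerm ρ').SameCycle s t ↔
      (ρ' * swap (none, false) (none, true)).SameCycle (lift s) (lift t) := by
  rw [collapsePerm, sameCycle_removeNone, sameCycle_removeNone, ← halfEdgeEquiv_lift,
    ← halfEdgeEquiv_lift, sameCycle_permCongr]

/-- The transposition of the two half-edges of the last edge, composed with the flip of all other
edges, is the flip of all edges. Hence the face permutation after contraction is the original one
with two points deleted. -/
theorem faces_collapsePerm (ρ' : Perm (Option E × Bool)) (s t : E × Bool) :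
    faces (collapsePerm ρ') s t ↔ faces ρ' (lift s) (lift t) := by
  change (collapsePerm ρ' * edgeFlip E).SameCycle s t ↔ (ρ' * edgeFlip (Option E)).SameCycle _ _
  have : (halfEdgeEquiv E).permCongr (ρ' * swap (none, false) (none, true)) *
      (edgeFlip E).optionCongr.optionCongr =
      (halfEdgeEquiv E).permCongr (ρ' * edgeFlip (Option E)) := by
    ext1 z
    obtain ⟨z, rfl⟩ := (halfEdgeEquiv E).surjective z
    simp only [Perm.mul_apply, Equiv.permCongr_apply, Equiv.symm_apply_apply]
    congr 2
    rcases cases_halfEdge z with rfl | rfl | ⟨s, rfl⟩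
    · change swap _ _ (none, false) = _
      simp
    · change swap _ _ (none, true) = _
      simp
    · change swap _ _ (lift (edgeFlip E s)) = lift (edgeFlip E s)
      rw [swap_apply_of_ne_of_ne] <;> simp [lift]
  rw [collapsePerm, ← removeNone_mul_optionCongr, ← removeNone_mul_optionCongr, this,
    sameCycle_removeNone, sameCycle_removeNone, ← halfEdgeEquiv_lift, ← halfEdgeEquiv_lift,
    sameCycle_permCongr]

variable [Finite E]

theorem IsCollapse.isRotation {y : Option E × Bool → Option V} {x : E × Bool → V}
    (hc : IsCollapse y x) {ρ' : Perm (Option E × Bool)} (hρ' : IsRotation y ρ') :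
    IsRotation x (collapsePerm ρ') := by
  obtain ⟨hb, u, ha, hx⟩ := hc
  intro s t
  rw [sameCycle_collapsePerm, sameCycle_mul_swap_iff (by rw [hρ', ha, hb]; simp)]
  simp only [hρ' _ _, ha, hb, hx]
  cases y (lift s) <;> cases y (lift t) <;> simp <;> grind

/-- Splitting a vertex `u` along a rotation: the half-edges from `h` up to the one before `t` are
moved to a new vertex, which is joined to `u` by a new edge. -/
theorem exists_split {x : E × Bool → V} {ρ : Perm (E × Bool)} (hρ : IsRotation x ρ)
    {h t : E × Bool} (hht : h ≠ t) (hx : x h = x t) :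
    ∃ (y : Option E × Bool → Option V) (ρ' : Perm (Option E × Bool)),
      IsCollapse y x ∧ IsRotation y ρ' ∧ collapsePerm ρ' = ρ ∧
      y (none, false) = some (x h) ∧
      y (lift h) = none ∧ y (lift (ρ.symm t)) = none ∧
      y (lift t) = some (x h) ∧ y (lift (ρ.symm h)) = some (x h) ∧
      ∀ s, s ≠ h → s ≠ t → y (lift (ρ.symm s)) = y (lift s) := by
  classical
  let e := halfEdgeEquiv E
  -- In this permutation the half-edge `(none, false)` is inserted into the cycle of `ρ` just before
  -- `h`, and `(none, true)` just before `t`.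
  let σ : Perm (Option (Option (E × Bool))) :=
    decomposeOption.symm (some (some t), decomposeOption.symm (some h, ρ))
  let τ : Perm (Option E × Bool) := e.symm.permCongr σ
  -- The transposition cuts that cycle in two: one part runs from `(none, true)` through `h` up to
  -- `ρ.symm t`, the other from `(none, false)` through `t` up to `ρ.symm h`.
  let ρ' := τ * swap (none, false) (none, true)
  have hσ : e.permCongr τ = σ := by ext z; simp [τ]
  have hcol : collapsePerm ρ' = ρ := by
    have h1 : removeNone σ = decomposeOption.symm (some h, ρ) :=
      congrArg Prod.snd (decomposeOption.apply_symm_apply _)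
    have h2 : removeNone (decomposeOption.symm (some h, ρ)) = ρ :=
      congrArg Prod.snd (decomposeOption.apply_symm_apply (some h, ρ))
    rw [collapsePerm, mul_swap_mul_swap]
    change removeNone (removeNone (e.permCongr τ)) = ρ
    rw [hσ, h1, h2]
  have hτa : τ (none, false) = lift h := by
    change e.symm (σ (some none)) = e.symm (some (some h))
    simp [σ, swap_apply_def, hht]
  have hτb : τ (none, true) = lift t := by
    change e.symm (σ none) = e.symm (some (some t))
    simp [σ]
  have hτl : ∀ s, τ (lift (ρ.symm s)) =
      if s = h then (none, false) else if s = t then (none, true) else lift s := by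
    intro s
    change e.symm (σ (some (some (ρ.symm s)))) = _
    rw [e.symm_apply_eq]
    by_cases h1 : s = h
    · subst h1
      simp [σ, swap_apply_def]
      rfl
    · by_cases h2 : s = t
      · subst h2
        simp [σ, swap_apply_def, h1]
        rfl
      · simp [σ, swap_apply_def, h1, h2]
        rfl
  have hρa : ρ' (none, false) = lift t := by rw [mul_swap_apply_left, hτb]
  have hρb : ρ' (none, true) = lift h := by rw [mul_swap_apply_right, hτa]
  have hρl : ∀ s, ρ' (lift (ρ.symm s)) =
      if s = h then (none, false) else if s = t then (none, true) else lift s := by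
    intro s
    rw [mul_swap_apply_of_ne (by simp [lift]) (by simp [lift]), hτl]
  have hback : ρ' * swap (none, false) (none, true) = τ := mul_swap_mul_swap _ _ _
  have hlift : ∀ s s', τ.SameCycle (lift s) (lift s') ↔ x s = x s' := by
    intro s s'
    rw [← hρ, ← hcol, sameCycle_collapsePerm, hback]
  have hah : ∀ s, τ.SameCycle (none, false) s ↔ τ.SameCycle (lift h) s := by
    intro s; rw [← hτa, sameCycle_apply_left]
  have hbt : ∀ s, τ.SameCycle (none, true) s ↔ τ.SameCycle (lift t) s := by
    intro s; rw [← hτb, sameCycle_apply_left]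
  have hab : ¬ ρ'.SameCycle (none, false) (none, true) := by
    refine not_sameCycle_mul_swap (by simp) ?_
    rw [hah, sameCycle_comm, hbt, hlift, hx]
  -- The vertex before the cut, where both halves of the new edge still sit at `x h`.
  let base : Option E × Bool → V := fun s => s.1.elim (x h) fun e => x (e, s.2)
  have hbase : ∀ s s', τ.SameCycle s s' ↔ base s = base s' := by
    have hbl : ∀ s, base (lift s) = x s := fun s => rfl
    have hba : base (none, false) = x h := rfl
    have hbb : base (none, true) = x h := rfl
    intro s s'
    rcases cases_halfEdge s with rfl | rfl | ⟨s, rfl⟩ <;>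
    rcases cases_halfEdge s' with rfl | rfl | ⟨s', rfl⟩ <;>
    simp only [hah, hbt, hlift, hbl, hba, hbb, hx, sameCycle_comm (x := lift _) (y := (none, _))] <;> grind
  have hmerge := sameCycle_mul_swap_iff hab
  rw [hback] at hmerge
  -- The part of the cut cycle that contains `(none, true)` becomes the new vertex.
  let y : Option E × Bool → Option V := fun s =>
    if ρ'.SameCycle (none, true) s then none else some (base s)
  have hy : IsRotation y ρ' := by
    intro s s'
    constructor
    · intro hs
      have h1 : ρ'.SameCycle (none, true) s ↔ ρ'.SameCycle (none, true) s' :=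
        ⟨fun h => h.trans hs, fun h => h.trans hs.symm⟩
      have h2 : base s = base s' := (hbase s s').1 ((hmerge s s').2 (Or.inl hs))
      simp [y, h1, h2]
    · intro hs
      by_cases h1 : ρ'.SameCycle (none, true) s <;> by_cases h2 : ρ'.SameCycle (none, true) s'
      · exact h1.symm.trans h2
      · simp [y, h1, h2] at hs
      · simp [y, h1, h2] at hs
      · simp only [y, h1, h2, if_false, Option.some.injEq] at hs
        rcases (hmerge s s').1 ((hbase s s').2 hs) with h | ⟨h3, h4⟩
        · exact h
        · exact (h3.resolve_right h1).symm.trans (h4.resolve_right h2)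
  have hya : y (none, false) = some (x h) := by
    simp only [y, sameCycle_comm, hab, if_false]
    rfl
  have hyb : y (none, true) = none := by simp [y, SameCycle.refl]
  refine ⟨y, ρ', ⟨hyb, x h, hya, fun s => ?_⟩, hy, hcol, hya, ?_, ?_, ?_, ?_, ?_⟩
  · by_cases hs : ρ'.SameCycle (none, true) (lift s)
    · have h1 := (hmerge (lift h) (lift s)).2 (Or.inr ⟨Or.inr ?_, Or.inr hs⟩)
      · rw [hlift] at h1
        simp [y, hs, h1]
      · rw [← hρb, sameCycle_apply_right]
    · simp [y, hs]; rfl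
  · rw [← hyb, ← hy, ← hρb, sameCycle_apply_left]
  · have := hρl t
    rw [if_neg hht.symm, if_pos rfl] at this
    rw [← hyb, ← hy, ← this, sameCycle_apply_right]
  · rw [← hya, ← hy, ← hρa, sameCycle_apply_left]
  · have := hρl h
    rw [if_pos rfl] at this
    rw [← hya, ← hy, ← this, sameCycle_apply_right]
  · intro s h1 h2
    have := hρl s
    rw [if_neg h1, if_neg h2] at this
    rw [← hy, ← this, sameCycle_apply_right]

end Collapse

/-! ### Contraction preserves components, faces and Euler characteristics. -/

section Transfer

variable {E V : Type*} {y : Option E × Bool → Option V} {x : E × Bool → V}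

theorem IsCollapse.linked_iff (hc : IsCollapse y x) (h1 : ∃ s, y (lift s) = y (none, false))
    (s t : E × Bool) : linked x s t ↔ linked y (lift s) (lift t) := by
  obtain ⟨hb, u, ha, hx⟩ := hc
  have hab : linked y (none, false) (none, true) := linked_flip _
  have hbase : ∀ s, x s = u → linked y (lift s) (none, false) := by
    intro s hs
    rw [hx] at hs
    cases hy : y (lift s) with
    | none => exact (linked y).trans (linked_of_eq (hy.trans hb.symm)) ((linked y).symm hab)
    | some v =>
      simp only [hy, Option.getD_some] at hs
      exact linked_of_eq (by rw [hy, ha, hs])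
  constructor
  · refine linked_le (r := (linked y).comap lift) (fun s t h => ?_) fun s => linked_flip (lift s)
    change linked y (lift s) (lift t)
    by_cases hs : x s = u
    · exact (linked y).trans (hbase s hs) ((linked y).symm (hbase t (h ▸ hs)))
    · have ht : x t ≠ u := h ▸ hs
      refine linked_of_eq ?_
      rw [hx] at hs ht
      rw [hx, hx] at h
      cases hy : y (lift s) <;> cases hy' : y (lift t) <;> simp_all
  · obtain ⟨s0, hs0⟩ := h1
    have hx0 : x s0 = u := by rw [hx, hs0, ha]; rfl
    -- Both halves of the last edge get the component of `s0`, an old half-edge that is at `u` after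
    -- the contraction.
    let c : Option E × Bool → Quotient (linked x) := fun s =>
      s.1.elim (Quotient.mk _ s0) fun e => Quotient.mk _ (e, s.2)
    have hcl : ∀ s, c (lift s) = Quotient.mk _ s := fun s => rfl
    have hca : c (none, false) = Quotient.mk _ s0 := rfl
    have hcb : c (none, true) = Quotient.mk _ s0 := rfl
    intro h
    have : (Setoid.ker c) (lift s) (lift t) := by
      refine linked_le (r := Setoid.ker c) (fun s t h => ?_) (fun s => ?_) h
      · have key : ∀ s, c s = Quotient.mk (linked x) s0 ∨
            ∃ s', s = lift s' ∧ y s = some (x s') := by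
          intro s
          rcases cases_halfEdge s with rfl | rfl | ⟨s, rfl⟩
          · exact Or.inl rfl
          · exact Or.inl rfl
          · cases hy : y (lift s) with
            | none =>
              refine Or.inl (Quotient.sound (linked_of_eq ?_))
              change x s = x s0
              rw [hx0, hx, hy]; rfl
            | some v => exact Or.inr ⟨s, rfl, by rw [hx, hy]; rfl⟩
        have key0 : ∀ s, y s = some u ∨ y s = none → c s = Quotient.mk (linked x) s0 := by
          rintro s hs
          rcases key s with h | ⟨s', rfl, h⟩
          · exact h
          · refine Quotient.sound (linked_of_eq ?_)
            change x s' = x s0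
            rw [hx0]
            simpa [h] using hs
        change c s = c t
        by_cases hs : y s = some u ∨ y s = none
        · rw [key0 s hs, key0 t (h ▸ hs)]
        · rcases cases_halfEdge s with rfl | rfl | ⟨s, rfl⟩
          · exact absurd (Or.inl ha) hs
          · exact absurd (Or.inr hb) hs
          · have ht := hs
            rw [h] at ht
            rcases cases_halfEdge t with rfl | rfl | ⟨t, rfl⟩
            · exact absurd (Or.inl ha) ht
            · exact absurd (Or.inr hb) ht
            · exact Quotient.sound (linked_of_eq (show x s = x t by rw [hx, hx, h]))
      · change c s = c _
        rcases cases_halfEdge s with rfl | rfl | ⟨s, rfl⟩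
        · rfl
        · rfl
        · exact Quotient.sound (linked_flip s)
    exact Quotient.exact this

theorem exists_linked_lift (h1 : ∃ s, y (lift s) = y (none, false)) (s' : Option E × Bool) :
    ∃ s, linked y (lift s) s' := by
  obtain ⟨s0, hs0⟩ := h1
  rcases cases_halfEdge s' with rfl | rfl | ⟨s, rfl⟩
  · exact ⟨s0, linked_of_eq hs0⟩
  · exact ⟨s0, (linked y).trans (linked_of_eq hs0) (linked_flip _)⟩
  · exact ⟨s, (linked y).refl _⟩

theorem IsCollapse.card_linked (hc : IsCollapse y x) (h1 : ∃ s, y (lift s) = y (none, false)) :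
    Nat.card (Quotient (linked x)) = Nat.card (Quotient (linked y)) :=
  card_quotient_eq_of_map lift (hc.linked_iff h1) (exists_linked_lift h1)

variable {ρ' : Perm (Option E × Bool)}

/-- Each end of the last edge carries another half-edge, so the face permutation sends either half
of that edge to an old half-edge. Hence no face disappears in the contraction. -/
theorem IsCollapse.exists_faces_lift (hc : IsCollapse y x) (hρ' : IsRotation y ρ')
    (h1 : ∃ s, y (lift s) = y (none, false)) (h2 : ∃ s, y (lift s) = y (none, true))
    (s' : Option E × Bool) : ∃ s, faces ρ' (lift s) s' := by
  have hab : y (none, false) ≠ y (none, true) := by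
    obtain ⟨hb, u, ha, -⟩ := hc
    simp [ha, hb]
  have step : ∀ (p q : Option E × Bool), y p ≠ y q → (p = (none, false) ∧ q = (none, true) ∨
      p = (none, true) ∧ q = (none, false)) → (∃ s, y (lift s) = y p) → ∃ s, ρ' p = lift s := by
    intro p q hpq hor ⟨s, hs⟩
    have h3 : y (ρ' p) = y p := by rw [← hρ', sameCycle_apply_left]
    have h4 : ρ' p ≠ q := fun h => hpq (by rw [← h3, h])
    have h5 : ρ' p ≠ p := by
      intro h
      have := ((hρ' _ _).2 hs).eq_of_right h
      rcases hor with ⟨rfl, -⟩ | ⟨rfl, -⟩ <;> simp [lift] at this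
    rcases cases_halfEdge (ρ' p) with h | h | h
    · rcases hor with ⟨rfl, rfl⟩ | ⟨rfl, rfl⟩ <;> contradiction
    · rcases hor with ⟨rfl, rfl⟩ | ⟨rfl, rfl⟩ <;> contradiction
    · exact h
  rcases cases_halfEdge s' with rfl | rfl | ⟨s, rfl⟩
  · obtain ⟨s, hs⟩ := step _ _ hab.symm (Or.inr ⟨rfl, rfl⟩) h2
    refine ⟨s, ?_⟩
    rw [← hs]
    change SameCycle _ _ _
    have : ρ' (none, true) = (ρ' * edgeFlip (Option E)) (none, false) := rfl
    rw [this, sameCycle_apply_left]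
  · obtain ⟨s, hs⟩ := step _ _ hab (Or.inl ⟨rfl, rfl⟩) h1
    refine ⟨s, ?_⟩
    rw [← hs]
    change SameCycle _ _ _
    have : ρ' (none, false) = (ρ' * edgeFlip (Option E)) (none, true) := rfl
    rw [this, sameCycle_apply_left]
  · exact ⟨s, (faces ρ').refl _⟩

variable [DecidableEq E] [Finite E]

theorem IsCollapse.totalBound_iff [Finite V] (hc : IsCollapse y x) (hρ' : IsRotation y ρ')
    (h1 : ∃ s, y (lift s) = y (none, false)) (h2 : ∃ s, y (lift s) = y (none, true)) (g : ℕ) :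
    TotalBound g x (collapsePerm ρ') ↔ TotalBound g y ρ' := by
  rw [TotalBound, TotalBound, hc.card_linked h1, card_quotient_eq_of_map lift
    (faces_collapsePerm ρ') (hc.exists_faces_lift hρ' h1 h2), Finite.card_option,
    Finite.card_option]
  omega

/-- The face counts agree. If the contracted edge lies in the component, one vertex and one edge are
lost and cancel; otherwise the component is untouched. -/
theorem IsCollapse.localBound_iff (hc : IsCollapse y x) (hρ' : IsRotation y ρ')
    (h1 : ∃ s, y (lift s) = y (none, false)) (h2 : ∃ s, y (lift s) = y (none, true)) (g : ℕ)
    (h : E × Bool) :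
    LocalBound g x (collapsePerm ρ') h ↔ LocalBound g y ρ' (lift h) := by
  have hl := hc.linked_iff h1
  have hF : classCount (faces (collapsePerm ρ')) {s | linked x s h} =
      classCount (faces ρ') {s | linked y s (lift h)} := by
    refine classCount_eq_of_map lift (faces_collapsePerm ρ') (fun s hs => (hl s h).1 hs)
      fun s' hs' => ?_
    obtain ⟨s, hs⟩ := hc.exists_faces_lift hρ' h1 h2 s'
    exact ⟨s, (hl s h).2 ((linked y).trans (hρ'.linked_of_faces hs) hs'), hs⟩
  obtain ⟨hb, u, ha, hx⟩ := hc
  have hab : linked y (none, false) (none, true) := linked_flip _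
  have hElift : ∀ e, linked x (e, false) h ↔ linked y (some e, false) (lift h) := fun e => hl _ _
  rw [LocalBound, LocalBound, hF]
  by_cases hah : linked y (none, false) (lift h)
  · have hE : {e : Option E | linked y (e, false) (lift h)} =
        insert none (some '' {e : E | linked x (e, false) h}) := by
      ext (_ | e)
      · simpa using hah
      · simp [hElift]
    have hV : y '' {s | linked y s (lift h)} = insert none (some '' (x '' {s | linked x s h})) := by
      ext v
      constructor
      · rintro ⟨s', hs', rfl⟩
        cases hy : y s' with
        | none => simp
        | some v =>
          right
          refine ⟨v, ?_, rfl⟩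
          rcases cases_halfEdge s' with rfl | rfl | ⟨s, rfl⟩
          · obtain ⟨s, hs⟩ := h1
            refine ⟨s, (hl s h).2 ((linked y).trans (linked_of_eq hs) hah), ?_⟩
            rw [hx, hs, hy]; rfl
          · rw [hb] at hy; cases hy
          · exact ⟨s, (hl s h).2 hs', by rw [hx, hy]; rfl⟩
      · rintro (rfl | ⟨v, ⟨s, hs, rfl⟩, rfl⟩)
        · exact ⟨(none, true), (linked y).trans ((linked y).symm hab) hah, hb⟩
        · cases hy : y (lift s) with
          | none => exact ⟨(none, false), hah, by rw [ha, hx, hy]; rfl⟩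
          | some v => exact ⟨lift s, (hl s h).1 hs, by rw [hx, hy]; rfl⟩
    rw [hE, hV, Set.ncard_insert_of_notMem (by simp), Set.ncard_insert_of_notMem (by simp),
      Set.ncard_image_of_injective _ (Option.some_injective _),
      Set.ncard_image_of_injective _ (Option.some_injective _)]
    omega
  · have hE : {e : Option E | linked y (e, false) (lift h)} =
        some '' {e : E | linked x (e, false) h} := by
      ext (_ | e)
      · simpa using hah
      · simp [hElift]
    have hbh : ¬ linked y (none, true) (lift h) := fun h' => hah ((linked y).trans hab h')
    have hsome : ∀ s, linked x s h → y (lift s) = some (x s) := by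
      intro s hs
      cases hy : y (lift s) with
      | none =>
        refine absurd ((linked y).trans (linked_of_eq ?_) ((hl s h).1 hs)) hbh
        rw [hb, hy]
      | some v => rw [hx, hy]; rfl
    have hV : y '' {s | linked y s (lift h)} = some '' (x '' {s | linked x s h}) := by
      ext v
      constructor
      · rintro ⟨s', hs', rfl⟩
        rcases cases_halfEdge s' with rfl | rfl | ⟨s, rfl⟩
        · exact absurd hs' hah
        · exact absurd hs' hbh
        · exact ⟨x s, ⟨s, (hl s h).2 hs', rfl⟩, (hsome s ((hl s h).2 hs')).symm⟩
      · rintro ⟨v, ⟨s, hs, rfl⟩, rfl⟩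
        exact ⟨lift s, (hl s h).1 hs, hsome s hs⟩
    rw [hE, hV, Set.ncard_image_of_injective _ (Option.some_injective _),
      Set.ncard_image_of_injective _ (Option.some_injective _)]

end Transfer

/-- Changing the representative of the component. -/
theorem LocalBound.congr {E V : Type*} {g : ℕ} {x : E × Bool → V} {ρ : Perm (E × Bool)}
    {s t : E × Bool} (hst : linked x s t) (h : LocalBound g x ρ s) : LocalBound g x ρ t := by
  have : ∀ u, linked x u s ↔ linked x u t := fun u =>
    ⟨fun h => (linked x).trans h hst, fun h => (linked x).trans h ((linked x).symm hst)⟩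
  simpa only [LocalBound, this] using h

/-- The properties of kernels that are counted: an embedding of total genus at most `g`, a
restriction on the number of components and, if `L` holds, genus at most `g'` for each
component. -/
def Admissible {E V : Type*} (g : ℕ) (K : ℕ → Prop) (L : Prop) (g' : ℕ) (x : E × Bool → V) : Prop :=
  (∃ ρ, IsRotation x ρ ∧ TotalBound g x ρ) ∧ K (Nat.card (Quotient (linked x))) ∧
    (L → ∀ h, ∃ ρ, IsRotation x ρ ∧ LocalBound g' x ρ h)

/-! ### One rotation for all genus bounds. -/

section Admissible

variable {E V : Type*} [Finite E]
  {y : Option E × Bool → Option V} {x : E × Bool → V} {g g' : ℕ} {K : ℕ → Prop} {L : Prop}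

theorem classCount_congr {α : Type*} {r r' : Setoid α} {S : Set α}
    (h : ∀ s ∈ S, ∀ t ∈ S, r s t ↔ r' s t) : classCount r S = classCount r' S := by
  have h1 : classCount (r.comap ((↑) : S → α)) Set.univ = classCount r S :=
    classCount_eq_of_map (↑) (fun s t => Iff.rfl) (fun s _ => s.2)
      fun b hb => ⟨⟨b, hb⟩, trivial, r.refl _⟩
  have h2 : classCount (r.comap ((↑) : S → α)) Set.univ = classCount r' S :=
    classCount_eq_of_map (↑) (fun s t => h s s.2 t t.2) (fun s _ => s.2)
      fun b hb => ⟨⟨b, hb⟩, trivial, r'.refl _⟩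
  rw [← h1, h2]

theorem card_quotient_eq_sum {α : Type*} [Finite α] {r c : Setoid α}
    [Fintype (Quotient c)] (h : ∀ s t, r s t → c s t) :
    Nat.card (Quotient r) = ∑ q : Quotient c, classCount r {s | c s q.out} := by
  classical
  have := Fintype.ofFinite α
  have := Fintype.ofFinite (Quotient r)
  let F : Quotient r → Quotient c := Quotient.map id fun s t hst => h s t hst
  rw [Nat.card_eq_fintype_card, ← Finset.card_univ,
    Finset.card_eq_sum_card_fiberwise (f := F) (t := Finset.univ) (fun _ _ => Finset.mem_univ _)]
  refine Finset.sum_congr rfl fun q _ => ?_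
  rw [classCount, ← Set.ncard_coe_finset]
  congr 1
  ext p
  induction p using Quotient.inductionOn with | h s => ?_
  have hF : F (Quotient.mk r s) = Quotient.mk c s := rfl
  have hq : ∀ t, Quotient.mk c t = q ↔ c t q.out := by
    intro t
    conv_lhs => rw [← q.out_eq]
    exact Quotient.eq
  simp only [Finset.coe_filter, Finset.mem_univ, true_and, Set.mem_ofPred_eq, Set.mem_image]
  rw [hF, hq]
  constructor
  · intro hs
    exact ⟨s, hs, rfl⟩
  · rintro ⟨t, ht, hst⟩
    exact c.trans (c.symm (h _ _ (Quotient.exact hst))) ht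

/-- Rotations of the components can be combined. -/
theorem exists_rotation_of_components (R : E × Bool → Perm (E × Bool))
    (hR : ∀ h, IsRotation x (R h)) :
    ∃ ρ, IsRotation x ρ ∧ ∀ q : Quotient (linked x),
      classCount (faces ρ) {s | linked x s q.out} =
        classCount (faces (R q.out)) {s | linked x s q.out} 
:= by
  let rep : E × Bool → E × Bool := fun s => (Quotient.mk (linked x) s).out
  have hrep : ∀ s t, linked x s t → rep s = rep t := fun s t h => by
    simp only [rep]; rw [Quotient.sound h]
  have hRx : ∀ r s, x (R r s) = x s := fun r s => by rw [← hR r, sameCycle_apply_left]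
  -- Each half-edge is rotated by the rotation chosen for the representative of its component.
  -- Rotations preserve vertices, hence components, so the pieces do not interfere.
  let f : E × Bool → E × Bool := fun s => R (rep s) s
  have hfx : ∀ s, x (f s) = x s := fun s => hRx _ s
  have hf : f.Injective := by
    intro s t hst
    have h1 : rep s = rep t := hrep s t (linked_of_eq (by rw [← hfx s, ← hfx t, hst]))
    simp only [f, h1] at hst
    exact (R (rep t)).injective hst
  let ρ : Perm (E × Bool) := Equiv.ofBijective f ⟨hf, Finite.surjective_of_injective hf⟩
  have hρ : ∀ s, ρ s = R (rep s) s := fun s => rfl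
  refine ⟨ρ, fun s t => ⟨fun h => h.apply_eq hfx, fun h => ?_⟩, fun q => classCount_congr ?_⟩
  · have key : ∀ n : ℕ, (ρ ^ n) s = (R (rep s) ^ n) s ∧ x ((R (rep s) ^ n) s) = x s := by
      intro n
      induction n with
      | zero => exact ⟨rfl, rfl⟩
      | succ n ih =>
        rw [pow_succ', mul_apply, pow_succ', mul_apply, ih.1, hρ,
          hrep _ s (linked_of_eq ih.2), hRx]
        exact ⟨rfl, ih.2⟩
    obtain ⟨n, hn⟩ := ((hR (rep s) s t).2 h).exists_nat_pow_eq
    exact ⟨n, by rw [zpow_natCast, (key n).1, hn]⟩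
  · have hq : ∀ s, linked x s q.out → rep s = q.out := by
      intro s hs
      simp only [rep, Quotient.sound hs, Quotient.out_eq]
    have key : ∀ σ π : Perm (E × Bool), (∀ s, linked x s q.out → σ s = π s ∧ linked x (σ s) q.out) →
        ∀ s t, linked x s q.out → σ.SameCycle s t → π.SameCycle s t := by
      intro σ π hσ s t hs hst
      obtain ⟨n, rfl⟩ := hst.exists_nat_pow_eq
      have : ∀ n : ℕ, (σ ^ n) s = (π ^ n) s ∧ linked x ((σ ^ n) s) q.out := by
        intro n
        induction n with
        | zero => exact ⟨rfl, hs⟩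
        | succ n ih =>
          rw [pow_succ', mul_apply, pow_succ', mul_apply, ← ih.1]
          exact hσ _ ih.2
      exact ⟨n, by rw [zpow_natCast, (this n).1]⟩
    have hagree : ∀ s, linked x s q.out → (ρ * edgeFlip E) s = (R q.out * edgeFlip E) s ∧
        linked x ((ρ * edgeFlip E) s) q.out := by
      intro s hs
      have h1 : linked x (edgeFlip E s) q.out :=
        (linked x).trans ((linked x).symm (linked_flip s)) hs
      rw [mul_apply, mul_apply, hρ, hq _ h1]
      exact ⟨rfl, (linked x).trans (linked_of_eq (hRx _ _)) h1⟩
    intro s hs t ht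
    exact ⟨key _ _ hagree s t hs,
      key _ _ (fun s hs => ⟨(hagree s hs).1.symm, (hagree s hs).1 ▸ (hagree s hs).2⟩) s t hs⟩

/-- There is a single rotation that witnesses all genus bounds. -/
theorem Admissible.exists_rotation (hx : Admissible g K L g' x) :
    ∃ ρ, IsRotation x ρ ∧ TotalBound g x ρ ∧ (L → ∀ h, LocalBound g' x ρ h) := by
  classical
  obtain ⟨⟨ρ₀, hρ₀, ht⟩, -, hL⟩ := hx
  by_cases l : L
  swap
  · exact ⟨ρ₀, hρ₀, ht, fun h => absurd h l⟩
  -- In each component keep whichever of the global and the local witness has more faces there. The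
  -- local bound survives and the total number of faces does not drop.
  have hR : ∀ h, ∃ ρ, IsRotation x ρ ∧ LocalBound g' x ρ h ∧
      classCount (faces ρ₀) {s | linked x s h} ≤ classCount (faces ρ) {s | linked x s h} := by
    intro h
    obtain ⟨ρ, hρ, hloc⟩ := hL l h
    rcases le_total (classCount (faces ρ₀) {s | linked x s h})
      (classCount (faces ρ) {s | linked x s h}) with hle | hle
    · exact ⟨ρ, hρ, hloc, hle⟩
    · refine ⟨ρ₀, hρ₀, ?_, le_rfl⟩
      rw [LocalBound] at hloc ⊢
      omega
  choose R hR hloc hle using hR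
  obtain ⟨ρ, hρ, heq⟩ := exists_rotation_of_components R hR
  have := Fintype.ofFinite (Quotient (linked x))
  refine ⟨ρ, hρ, ?_, fun _ h => ?_⟩
  · have h1 := card_quotient_eq_sum (r := faces ρ₀) (c := linked x)
      fun s t => hρ₀.linked_of_faces
    have h2 := card_quotient_eq_sum (r := faces ρ) (c := linked x) fun s t => hρ.linked_of_faces
    have h3 : Nat.card (Quotient (faces ρ₀)) ≤ Nat.card (Quotient (faces ρ)) := by
      rw [h1, h2]
      refine Finset.sum_le_sum fun q _ => ?_
      rw [heq]
      exact hle _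
    rw [TotalBound] at ht ⊢
    omega
  · have : linked x (Quotient.mk (linked x) h).out h := Quotient.exact (Quotient.out_eq _)
    refine LocalBound.congr this ?_
    rw [LocalBound, heq]
    exact hloc _

variable [DecidableEq E] [Finite V]

theorem Admissible.collapse (hy : Admissible g K L g' y) (hc : IsCollapse y x)
    (h1 : ∃ s, y (lift s) = y (none, false)) (h2 : ∃ s, y (lift s) = y (none, true)) :
    Admissible g K L g' x := by
  obtain ⟨⟨ρ', hρ', ht⟩, hK, hL⟩ := hy
  refine ⟨⟨_, hc.isRotation hρ', (hc.totalBound_iff hρ' h1 h2 g).2 ht⟩,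
    by rwa [hc.card_linked h1], fun l h => ?_⟩
  obtain ⟨ρ', hρ', hloc⟩ := hL l (lift h)
  exact ⟨_, hc.isRotation hρ', (hc.localBound_iff hρ' h1 h2 g' h).2 hloc⟩

theorem Admissible.of_collapse (hx : Admissible g K L g' x) (hc : IsCollapse y x)
    (h1 : ∃ s, y (lift s) = y (none, false)) (h2 : ∃ s, y (lift s) = y (none, true))
    {ρ' : Perm (Option E × Bool)} (hρ' : IsRotation y ρ') (ht : TotalBound g x (collapsePerm ρ'))
    (hl : L → ∀ h, LocalBound g' x (collapsePerm ρ') h) : Admissible g K L g' y := by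
  refine ⟨⟨ρ', hρ', (hc.totalBound_iff hρ' h1 h2 g).1 ht⟩, hc.card_linked h1 ▸ hx.2.1,
    fun l h' => ?_⟩
  obtain ⟨h, hh⟩ := exists_linked_lift h1 h'
  exact ⟨ρ', hρ', LocalBound.congr hh ((hc.localBound_iff hρ' h1 h2 g' h).1 (hl l h))⟩

end Admissible

/-! ### Invariance under relabelling vertices and under relabelling and reversing edges. -/

section Relabel

variable {E V : Type*} {g g' : ℕ} {K : ℕ → Prop} {L : Prop}

theorem linked_comp {W : Type*} (σ : V ≃ W) (x : E × Bool → V) : linked (σ ∘ x) = linked x := by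
  simp [linked]

theorem Admissible.comp_vertex {W : Type*} (σ : V ≃ W) {x : E × Bool → V}
    (hx : Admissible g K L g' x) : Admissible g K L g' (σ ∘ x) := by
  have hrot : ∀ ρ, IsRotation (σ ∘ x) ρ ↔ IsRotation x ρ := fun ρ => by simp [IsRotation]
  have hW : Nat.card W = Nat.card V := Nat.card_congr σ.symm
  have htot : ∀ ρ, TotalBound g (σ ∘ x) ρ ↔ TotalBound g x ρ := fun ρ => by
    rw [TotalBound, TotalBound, linked_comp, hW]
  have hloc : ∀ ρ h, LocalBound g' (σ ∘ x) ρ h ↔ LocalBound g' x ρ h := fun ρ h => by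
    rw [LocalBound, LocalBound, linked_comp, Set.image_comp,
      Set.ncard_image_of_injective _ σ.injective]
  rw [Admissible, linked_comp]
  simp only [hrot, htot, hloc]
  exact hx

end Relabel

theorem sameCycle_of_semiconj {α β : Type*} {f : Perm α} {f' : Perm β} {i : α → β}
    (hi : i.Injective) (h : ∀ s, f' (i s) = i (f s)) (s t : α) :
    f'.SameCycle (i s) (i t) ↔ f.SameCycle s t := by
  have hpow : ∀ (n : ℤ) (s : α), (f' ^ n) (i s) = i ((f ^ n) s) := by
    intro n
    induction n using Int.induction_on with
    | zero => intro s; rfl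
    | succ n ih => intro s; rw [zpow_add_one, mul_apply, h, ih, zpow_add_one, mul_apply]
    | pred n ih =>
      intro s
      have : f'⁻¹ (i s) = i (f⁻¹ s) := by
        rw [Perm.inv_eq_iff_eq, h]; simp
      rw [zpow_sub_one, mul_apply, this, ih, zpow_sub_one, mul_apply]
  exact exists_congr fun n => by rw [hpow, hi.eq_iff]

section Reorient

variable {E E' V : Type*}

/-- Relabelling the edges and reversing some of them. -/
def reorient (τ : E' ≃ E) (b : E' → Bool) : E' × Bool ≃ E × Bool where
  toFun s := (τ s.1, xor (b s.1) s.2)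
  invFun s := (τ.symm s.1, xor (b (τ.symm s.1)) s.2)
  left_inv s := by simp
  right_inv s := by simp

variable (τ : E' ≃ E) (b : E' → Bool)

theorem reorient_flip (s : E' × Bool) :
    reorient τ b (edgeFlip E' s) = edgeFlip E (reorient τ b s) := by
  obtain ⟨e, β⟩ := s
  simp [reorient]

variable {x : E × Bool → V}

theorem linked_reorient (s t : E' × Bool) :
    linked (x ∘ reorient τ b) s t ↔ linked x (reorient τ b s) (reorient τ b t) := by
  constructor
  · refine linked_le (r := (linked x).comap (reorient τ b)) (fun s t h => linked_of_eq h)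
      fun s => ?_
    change linked x _ _
    rw [reorient_flip]
    exact linked_flip _
  · intro h
    have := linked_le (r := (linked (x ∘ reorient τ b)).comap (reorient τ b).symm)
      (fun s t h => linked_of_eq (by simpa using h)) (fun s => ?_) h
    · change linked _ _ _ at this
      simpa using this
    · obtain ⟨s, rfl⟩ := (reorient τ b).surjective s
      change linked _ _ _
      rw [← reorient_flip, Equiv.symm_apply_apply, Equiv.symm_apply_apply]
      exact linked_flip s

/-- The rotation transported along a relabelling. -/
def reorientPerm (ρ : Perm (E × Bool)) : Perm (E' × Bool) := (reorient τ b).symm.permCongr ρ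

theorem reorient_reorientPerm (ρ : Perm (E × Bool)) (s : E' × Bool) :
    reorient τ b (reorientPerm τ b ρ s) = ρ (reorient τ b s) := by
  simp [reorientPerm]

theorem faces_reorientPerm (ρ : Perm (E × Bool)) (s t : E' × Bool) :
    faces (reorientPerm τ b ρ) s t ↔ faces ρ (reorient τ b s) (reorient τ b t) := by
  symm
  refine sameCycle_of_semiconj (reorient τ b).injective (fun s => ?_) s t
  rw [mul_apply, mul_apply, reorient_reorientPerm, reorient_flip]

theorem isRotation_reorientPerm {ρ : Perm (E × Bool)} :
    IsRotation (x ∘ reorient τ b) (reorientPerm τ b ρ) ↔ IsRotation x ρ := by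
  have key : ∀ s t, ρ.SameCycle (reorient τ b s) (reorient τ b t) ↔
      (reorientPerm τ b ρ).SameCycle s t := fun s t =>
    sameCycle_of_semiconj (reorient τ b).injective
      (fun s => (reorient_reorientPerm τ b ρ s).symm) s t
  rw [IsRotation, IsRotation, (reorient τ b).forall_congr_left]
  refine forall_congr' fun s => ?_
  rw [(reorient τ b).forall_congr_left]
  refine forall_congr' fun t => ?_
  rw [← key]
  simp

theorem card_linked_reorient :
    Nat.card (Quotient (linked (x ∘ reorient τ b))) = Nat.card (Quotient (linked x)) :=
  card_quotient_eq_of_map (reorient τ b) (linked_reorient τ b) fun s =>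
    ⟨(reorient τ b).symm s, by rw [Equiv.apply_symm_apply]⟩

theorem card_faces_reorientPerm (ρ : Perm (E × Bool)) :
    Nat.card (Quotient (faces (reorientPerm τ b ρ))) = Nat.card (Quotient (faces ρ)) :=
  card_quotient_eq_of_map (reorient τ b) (faces_reorientPerm τ b ρ) fun s =>
    ⟨(reorient τ b).symm s, by rw [Equiv.apply_symm_apply]⟩

theorem totalBound_reorientPerm {g : ℕ} {ρ : Perm (E × Bool)} :
    TotalBound g (x ∘ reorient τ b) (reorientPerm τ b ρ) ↔ TotalBound g x ρ := by
  rw [TotalBound, TotalBound, card_linked_reorient, card_faces_reorientPerm, Nat.card_congr τ]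

theorem localBound_reorientPerm {g : ℕ} {ρ : Perm (E × Bool)} (h : E' × Bool) :
    LocalBound g (x ∘ reorient τ b) (reorientPerm τ b ρ) h ↔ LocalBound g x ρ (reorient τ b h) := by
  have hF : classCount (faces (reorientPerm τ b ρ)) {s | linked (x ∘ reorient τ b) s h} =
      classCount (faces ρ) {s | linked x s (reorient τ b h)} :=
    classCount_eq_of_map (reorient τ b) (faces_reorientPerm τ b ρ)
      (fun s hs => (linked_reorient τ b s h).1 hs) fun s hs =>
      ⟨(reorient τ b).symm s, (linked_reorient τ b _ h).2 (by simpa using hs),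
        by rw [Equiv.apply_symm_apply]⟩
  have hV : (x ∘ reorient τ b) '' {s | linked (x ∘ reorient τ b) s h} =
      x '' {s | linked x s (reorient τ b h)} := by
    rw [Set.image_comp]
    congr 1
    ext s
    obtain ⟨s, rfl⟩ := (reorient τ b).surjective s
    simp [linked_reorient]
  have hE : {e | linked x (e, false) (reorient τ b h)} =
      τ '' {e | linked (x ∘ reorient τ b) (e, false) h} := by
    ext e
    obtain ⟨e, rfl⟩ := τ.surjective e
    have h1 : linked x (τ e, false) (τ e, b e) := by
      cases b e
      · exact (linked x).refl _
      · exact linked_flip _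
    simp only [Set.mem_ofPred_eq, Set.mem_image, EmbeddingLike.apply_eq_iff_eq, exists_eq_right,
      linked_reorient]
    have h2 : reorient τ b (e, false) = (τ e, b e) := by simp [reorient]
    rw [h2]
    exact ⟨fun h => (linked x).trans ((linked x).symm h1) h, fun h => (linked x).trans h1 h⟩
  rw [LocalBound, LocalBound, hF, hV, hE, Set.ncard_image_of_injective _ τ.injective]

theorem Admissible.reorient {g g' : ℕ} {K : ℕ → Prop} {L : Prop} (hx : Admissible g K L g' x) :
    Admissible g K L g' (x ∘ reorient τ b) := by
  obtain ⟨⟨ρ, hρ, ht⟩, hK, hL⟩ := hx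
  refine ⟨⟨_, (isRotation_reorientPerm τ b).2 hρ, (totalBound_reorientPerm τ b).2 ht⟩,
    by rwa [card_linked_reorient], fun l h => ?_⟩
  obtain ⟨ρ, hρ, hloc⟩ := hL l (HalfEdge.reorient τ b h)
  exact ⟨_, (isRotation_reorientPerm τ b).2 hρ, (localBound_reorientPerm τ b h).2 hloc⟩

end Reorient

/-- The multigraph with the given ends of its edges. -/
noncomputable def toMultigraph {E V : Type*} (x : E × Bool → V) : Multigraph V := fun e =>
  Nat.card {i : E // s(x (i, false), x (i, true)) = e}

/-- Transitivity of the action on representations of one multigraph: match the edges over each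
unordered pair arbitrarily; matched edges then agree up to reversal. -/
theorem exists_reorient {E E' V : Type*} [Finite E] [Finite E'] {x : E × Bool → V}
    {x' : E' × Bool → V} (h : toMultigraph x' = toMultigraph x) :
    ∃ (τ : E' ≃ E) (b : E' → Bool), x' = x ∘ reorient τ b := by
  have hfib : ∀ e, Nonempty ({i : E' // s(x' (i, false), x' (i, true)) = e} ≃
      {i : E // s(x (i, false), x (i, true)) = e}) := fun e =>
    Finite.card_eq.1 (congrFun h e)
  let F := fun e => (hfib e).some
  let τ : E' ≃ E := (Equiv.sigmaFiberEquiv _).symm.trans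
    ((Equiv.sigmaCongrRight F).trans (Equiv.sigmaFiberEquiv _))
  have hτ : ∀ i, s(x (τ i, false), x (τ i, true)) = s(x' (i, false), x' (i, true)) := fun i =>
    (F _ ⟨i, rfl⟩).2
  have hb : ∀ i, ∃ b : Bool, ∀ β, x' (i, β) = x (τ i, xor b β) := by
    intro i
    rcases Sym2.eq_iff.1 (hτ i) with ⟨h1, h2⟩ | ⟨h1, h2⟩
    · exact ⟨false, by rintro (_ | _) <;> simp [h1, h2]⟩
    · exact ⟨true, by rintro (_ | _) <;> simp [h1, h2]⟩
  choose b hb using hb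
  exact ⟨τ, b, funext fun s => hb s.1 s.2⟩

theorem toMultigraph_reorient {E E' V : Type*} (τ : E' ≃ E) (b : E' → Bool) (x : E × Bool → V) :
    toMultigraph (x ∘ reorient τ b) = toMultigraph x := by
  ext e
  refine Nat.card_congr (τ.subtypeEquiv fun i => ?_)
  cases h : b i <;> simp [reorient, h, Sym2.eq_swap]

/-! ### Components and embeddability of multigraphs in terms of half-edges. -/

section Bridge

variable {E V : Type*} {x : E × Bool → V}

theorem toSimple_adj_iff {V : Type*} {M : Multigraph V} {v w : V} :
    M.toSimple.Adj v w ↔ M s(v, w) ≠ 0 ∧ v ≠ w := by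
  rw [Multigraph.toSimple, SimpleGraph.fromEdgeSet_adj]
  rfl

theorem toSimple_adj [Finite E] {v w : V} : (toMultigraph x).toSimple.Adj v w ↔
    v ≠ w ∧ ∃ i, s(x (i, false), x (i, true)) = s(v, w) := by
  rw [toSimple_adj_iff, and_comm, toMultigraph, Nat.card_ne_zero, nonempty_subtype]
  exact and_congr_right fun _ => and_iff_left inferInstance

theorem linked_iff_reachable [Finite E] {s t : E × Bool} :
    linked x s t ↔ (toMultigraph x).toSimple.Reachable (x s) (x t) := by
  constructor
  · refine linked_le (r := (toMultigraph x).toSimple.reachableSetoid.comap x) (fun s t h => ?_)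
      fun s => ?_
    · change (toMultigraph x).toSimple.Reachable (x s) (x t)
      rw [h]
    · change (toMultigraph x).toSimple.Reachable (x s) (x (edgeFlip E s))
      by_cases hs : x s = x (edgeFlip E s)
      · rw [← hs]
      · refine SimpleGraph.Adj.reachable (toSimple_adj.2 ⟨hs, s.1, ?_⟩)
        obtain ⟨e, _ | _⟩ := s
        · rfl
        · exact Sym2.eq_swap
  · rintro ⟨p⟩
    generalize hv : x s = v at p
    generalize hw : x t = w at p
    induction p generalizing s t with
    | nil => exact linked_of_eq (hv.trans hw.symm)
    | cons hadj p ih =>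
      obtain ⟨-, i, hi⟩ := toSimple_adj.1 hadj
      rcases Sym2.eq_iff.1 hi with ⟨h1, h2⟩ | ⟨h1, h2⟩
      · exact (linked x).trans (linked_of_eq (hv.trans h1.symm))
          ((linked x).trans (linked_flip _) (ih h2 hw))
      · exact (linked x).trans (linked_of_eq (hv.trans h2.symm))
          ((linked x).trans (linked_flip _) (ih h1 hw))

theorem numComponents_toMultigraph [Finite E] (hx : x.Surjective) :
    (toMultigraph x).numComponents = Nat.card (Quotient (linked x)) := by
  symm
  exact card_quotient_eq_of_map (r' := (toMultigraph x).toSimple.reachableSetoid) x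
    (fun s t => linked_iff_reachable) fun v => (hx v).imp fun s hs => by rw [hs]

/-- Surjectivity rules out isolated vertices, which carry faces and components that half-edges do
not see. -/
theorem embeddableOn_toMultigraph [Finite E] (hx : x.Surjective) {g : ℕ} :
    (toMultigraph x).EmbeddableOn g ↔ ∃ ρ, IsRotation x ρ ∧ TotalBound g x ρ := by
  have hiso : ∀ {n : ℕ} {x' : Fin n × Bool → V}, x'.Surjective →
      Nat.card {v : V // v ∉ Set.range x'} = 0 := by
    intro n x' hx'
    rw [hx'.range_eq]
    simp
  constructor
  · rintro ⟨R, hR⟩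
    obtain ⟨τ, b, hτ⟩ := exists_reorient (x := R.ends) (x' := x) (by
      ext e; exact (R.card_ends e).symm)
    have hsurj : R.ends.Surjective := by
      rw [hτ] at hx; exact hx.of_comp
    refine ⟨reorientPerm τ b R.rot, ?_, ?_⟩
    · have h : IsRotation R.ends R.rot := R.sameCycle_rot
      rwa [← isRotation_reorientPerm τ b, ← hτ] at h
    · rw [numComponents_toMultigraph hx, Multigraph.RotationSystem.numFaces, hiso hsurj] at hR
      have hE : Nat.card E = R.numEdges := by rw [Nat.card_congr τ, Nat.card_fin]
      rw [TotalBound, card_faces_reorientPerm, hE]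
      exact hR
  · rintro ⟨ρ, hρ, ht⟩
    obtain ⟨n, ⟨τ⟩⟩ := Finite.exists_equiv_fin E
    let b : Fin n → Bool := fun _ => false
    let R : (toMultigraph x).RotationSystem :=
      { numEdges := n
        ends := x ∘ reorient τ.symm b
        card_ends := fun e => congrFun (toMultigraph_reorient τ.symm b x) e
        rot := reorientPerm τ.symm b ρ
        sameCycle_rot := (isRotation_reorientPerm τ.symm b).2 hρ }
    refine ⟨R, ?_⟩
    have h1 : R.numFaces = Nat.card (Quotient (faces (reorientPerm τ.symm b ρ))) + 0 := by
      rw [← hiso (hx.comp (reorient τ.symm b).surjective)]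
      rfl
    have hE : Nat.card E = R.numEdges := by rw [Nat.card_congr τ, Nat.card_fin]
    rw [numComponents_toMultigraph hx, h1, card_faces_reorientPerm, ← hE]
    exact ht

end Bridge

/-! ### The genus of a component. -/

section Component

variable {E V : Type*} {x : E × Bool → V}

/-- The edges of the component of the half-edge `h`. -/
abbrev ComponentEdge (x : E × Bool → V) (h : E × Bool) : Type _ := {e : E // linked x (e, false) h}

theorem linked_iff_edge {h s : E × Bool} : linked x s h ↔ linked x (s.1, false) h := by
  obtain ⟨e, _ | _⟩ := s
  · rfl
  · exact ⟨fun h => (linked x).trans (linked_flip _) h, fun h => (linked x).trans (linked_flip _) h⟩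

/-- The half-edges of a component as half-edges of the whole multigraph. -/
def ofComponent {h : E × Bool} (s : ComponentEdge x h × Bool) : E × Bool := (s.1.1, s.2)

theorem ofComponent_injective {h : E × Bool} :
    (ofComponent : ComponentEdge x h × Bool → E × Bool).Injective := by
  rintro ⟨⟨e, _⟩, b⟩ ⟨⟨e', _⟩, b'⟩ hs
  simpa [ofComponent] using hs

theorem linked_ofComponent {h : E × Bool} (s : ComponentEdge x h × Bool) :
    linked x (ofComponent s) h := linked_iff_edge.2 s.1.2

/-- A half-edge linked to `h`, as a half-edge of the component of `h`. -/
def toComponent {h : E × Bool} (s : E × Bool) (hs : linked x s h) : ComponentEdge x h × Bool :=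
  (⟨s.1, linked_iff_edge.1 hs⟩, s.2)

@[simp] theorem ofComponent_toComponent {h : E × Bool} (s : E × Bool) (hs : linked x s h) :
    ofComponent (toComponent s hs) = s := rfl

theorem mem_supp_iff [Finite E] {h s : E × Bool} :
    x s ∈ ((toMultigraph x).toSimple.connectedComponentMk (x h)).supp ↔ linked x s h := by
  rw [SimpleGraph.ConnectedComponent.mem_supp_iff, SimpleGraph.ConnectedComponent.eq,
    linked_iff_reachable]

/-- The ends of the edges of a component. -/
noncomputable def componentEnds [Finite E] (x : E × Bool → V) (h : E × Bool) :
    ComponentEdge x h × Bool → ((toMultigraph x).toSimple.connectedComponentMk (x h)).supp :=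
  fun s => ⟨x (ofComponent s), mem_supp_iff.2 (linked_ofComponent s)⟩

variable [Finite E] {h : E × Bool}

theorem componentEnds_surjective (hx : x.Surjective) : (componentEnds x h).Surjective := by
  rintro ⟨v, hv⟩
  obtain ⟨s, rfl⟩ := hx v
  exact ⟨toComponent s (mem_supp_iff.1 hv), rfl⟩

theorem toMultigraph_componentEnds : toMultigraph (componentEnds x h) =
    (toMultigraph x).induce ((toMultigraph x).toSimple.connectedComponentMk (x h)).supp := by
  ext e
  induction e using Sym2.inductionOn with | hf v w => ?_
  have hinj : ∀ i : ComponentEdge x h, s(componentEnds x h (i, false), componentEnds x h (i, true)) =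
      s(v, w) ↔ s(x (i.1, false), x (i.1, true)) = s(v.1, w.1) := by
    intro i
    rw [← (Sym2.map.injective Subtype.val_injective).eq_iff]
    rfl
  refine Nat.card_congr
    { toFun := fun i => ⟨i.1.1, (hinj i.1).1 i.2⟩
      invFun := fun i => ⟨⟨i.1, ?_⟩, (hinj ⟨i.1, _⟩).2 i.2⟩
      left_inv := fun i => rfl
      right_inv := fun i => rfl }
  rw [← mem_supp_iff]
  rcases Sym2.eq_iff.1 i.2 with h | h
  · rw [h.1]; exact v.2
  · rw [h.1]; exact w.2

theorem card_linked_componentEnds (hx : x.Surjective) :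
    Nat.card (Quotient (linked (componentEnds x h))) = 1 := by
  rw [← numComponents_toMultigraph (componentEnds_surjective hx), toMultigraph_componentEnds,
    Multigraph.numComponents, Nat.card_eq_one_iff_unique]
  set C := (toMultigraph x).toSimple.connectedComponentMk (x h)
  have hG : ((toMultigraph x).induce C.supp).toSimple = (toMultigraph x).toSimple.induce C.supp := by
    ext v w
    change _ ↔ (toMultigraph x).toSimple.Adj v.1 w.1
    rw [toSimple_adj_iff, toSimple_adj_iff, ne_eq v.1, Subtype.val_inj]
    rfl
  have hconn : ((toMultigraph x).toSimple.induce C.supp).Connected := C.connected_toSimpleGraph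
  rw [hG]
  exact ⟨hconn.preconnected.subsingleton_connectedComponent, hconn.nonempty.map fun v => SimpleGraph.connectedComponentMk _ v⟩

theorem totalBound_componentEnds (hx : x.Surjective) {ρ : Perm (E × Bool)}
    {ρ' : Perm (ComponentEdge x h × Bool)} (hρ' : ∀ s, ρ (ofComponent s) = ofComponent (ρ' s))
    {g : ℕ} : TotalBound g (componentEnds x h) ρ' ↔ LocalBound g x ρ h := by
  have hF : Nat.card (Quotient (faces ρ')) = classCount (faces ρ) {s | linked x s h} := by
    rw [← classCount_univ]
    refine classCount_eq_of_map ofComponent (fun s t => ?_) (fun s _ => linked_ofComponent s)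
      fun s hs => ⟨toComponent s hs, trivial, (faces ρ).refl _⟩
    symm
    refine sameCycle_of_semiconj ofComponent_injective (fun s => ?_) s t
    rw [mul_apply, mul_apply, ← hρ']
    rfl
  have hV : ((toMultigraph x).toSimple.connectedComponentMk (x h)).supp =
      x '' {s | linked x s h} := by
    ext v
    obtain ⟨s, rfl⟩ := hx v
    rw [mem_supp_iff]
    constructor
    · exact fun hs => ⟨s, hs, rfl⟩
    · rintro ⟨t, ht, hts⟩
      exact (linked x).trans (linked_of_eq hts.symm) ht
  rw [TotalBound, LocalBound, card_linked_componentEnds hx, hF, Nat.card_coe_set_eq, hV]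
  rfl

theorem isRotation_componentEnds_iff {ρ : Perm (E × Bool)}
    {ρ' : Perm (ComponentEdge x h × Bool)} (hρ' : ∀ s, ρ (ofComponent s) = ofComponent (ρ' s)) :
    IsRotation (componentEnds x h) ρ' ↔ ∀ s t, linked x s h → linked x t h →
      (ρ.SameCycle s t ↔ x s = x t) := by
  have key := sameCycle_of_semiconj ofComponent_injective hρ'
  constructor
  · intro hr s t hs ht
    have := hr (toComponent s hs) (toComponent t ht)
    rw [← key, ofComponent_toComponent, ofComponent_toComponent] at this
    rw [this, ← Subtype.val_inj]
    rfl
  · intro hr s t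
    rw [← key, hr _ _ (linked_ofComponent s) (linked_ofComponent t), ← Subtype.val_inj]
    rfl

theorem exists_restrict {ρ : Perm (E × Bool)} (hρ : IsRotation x ρ) :
    ∃ ρ' : Perm (ComponentEdge x h × Bool), ∀ s, ρ (ofComponent s) = ofComponent (ρ' s) := by
  have hl : ∀ s, linked x (ρ s) s := fun s =>
    linked_of_eq (by rw [← hρ, sameCycle_apply_left])
  let f : ComponentEdge x h × Bool → ComponentEdge x h × Bool := fun s =>
    toComponent (ρ (ofComponent s)) ((linked x).trans (hl _) (linked_ofComponent s))
  have hf : ∀ s, ofComponent (f s) = ρ (ofComponent s) := fun s => rfl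
  have hinj : f.Injective := by
    intro s t hst
    apply ofComponent_injective (x := x) (h := h)
    apply ρ.injective
    rw [← hf, ← hf, hst]
  exact ⟨Equiv.ofBijective f ⟨hinj, Finite.surjective_of_injective hinj⟩, fun s => rfl⟩

/-- Use the given rotation on the component and `ρ₀` elsewhere; this turns an embedding of one
component into a rotation of the whole multigraph. -/
theorem exists_extend {ρ₀ : Perm (E × Bool)} (hρ₀ : IsRotation x ρ₀)
    {ρ' : Perm (ComponentEdge x h × Bool)} (hρ' : IsRotation (componentEnds x h) ρ') :
    ∃ ρ, IsRotation x ρ ∧ ∀ s, ρ (ofComponent s) = ofComponent (ρ' s) := by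
  classical
  let f : E × Bool → E × Bool := fun s =>
    if hs : linked x s h then ofComponent (ρ' (toComponent s hs)) else ρ₀ s
  have hfp : ∀ s (hs : linked x s h), f s = ofComponent (ρ' (toComponent s hs)) := fun s hs =>
    dif_pos hs
  have hfn : ∀ s, ¬ linked x s h → f s = ρ₀ s := fun s hs => dif_neg hs
  have hfx : ∀ s, x (f s) = x s := by
    intro s
    by_cases hs : linked x s h
    · rw [hfp s hs]
      have := (hρ' (ρ' (toComponent s hs)) (toComponent s hs)).1
        (sameCycle_apply_left.2 (SameCycle.refl _ _))
      exact congrArg Subtype.val this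
    · rw [hfn s hs, ← hρ₀, sameCycle_apply_left]
  have hfl : ∀ s, linked x (f s) h ↔ linked x s h := fun s =>
    ⟨fun hs => (linked x).trans (linked_of_eq (hfx s).symm) hs,
      fun hs => (linked x).trans (linked_of_eq (hfx s)) hs⟩
  have hinj : f.Injective := by
    intro s t hst
    by_cases hs : linked x s h
    · have ht : linked x t h := by rwa [← hfl, ← hst, hfl]
      rw [hfp s hs, hfp t ht] at hst
      have := ρ'.injective (ofComponent_injective hst)
      rw [← ofComponent_toComponent s hs, this, ofComponent_toComponent]
    · have ht : ¬ linked x t h := by rwa [← hfl, ← hst, hfl]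
      rw [hfn s hs, hfn t ht] at hst
      exact ρ₀.injective hst
  let ρ : Perm (E × Bool) := Equiv.ofBijective f ⟨hinj, Finite.surjective_of_injective hinj⟩
  have hρ : ∀ s, ρ (ofComponent s) = ofComponent (ρ' s) := fun s =>
    (hfp _ (linked_ofComponent s)).trans rfl
  refine ⟨ρ, fun s t => ⟨fun h => h.apply_eq hfx, fun hst => ?_⟩, hρ⟩
  by_cases hs : linked x s h
  · have ht : linked x t h := (linked x).trans (linked_of_eq hst.symm) hs
    exact ((isRotation_componentEnds_iff hρ).1 hρ' s t hs ht).2 hst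
  · obtain ⟨n, rfl⟩ := ((hρ₀ s t).2 hst).exists_nat_pow_eq
    refine ⟨n, ?_⟩
    rw [zpow_natCast]
    clear hst
    induction n with
    | zero => rfl
    | succ n ih =>
      rw [pow_succ', mul_apply, ih, pow_succ', mul_apply]
      refine hfn _ fun h' => hs ((linked x).trans (linked_of_eq ?_) h')
      rw [← hρ₀, sameCycle_pow_right]

theorem genus_component_lt_iff (hx : x.Surjective) {ρ₀ : Perm (E × Bool)} (hρ₀ : IsRotation x ρ₀)
    {g : ℕ} : ((toMultigraph x).induce
        ((toMultigraph x).toSimple.connectedComponentMk (x h)).supp).genus < g + 1 ↔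
      ∃ ρ, IsRotation x ρ ∧ LocalBound g x ρ h := by
  have hemb : ∀ {g}, ((toMultigraph x).induce
      ((toMultigraph x).toSimple.connectedComponentMk (x h)).supp).EmbeddableOn g ↔
      ∃ ρ, IsRotation x ρ ∧ LocalBound g x ρ h := by
    intro g
    rw [← toMultigraph_componentEnds, embeddableOn_toMultigraph (componentEnds_surjective hx)]
    constructor
    · rintro ⟨ρ', hρ', ht⟩
      obtain ⟨ρ, hρ, he⟩ := exists_extend hρ₀ hρ'
      exact ⟨ρ, hρ, (totalBound_componentEnds hx he).1 ht⟩
    · rintro ⟨ρ, hρ, hl⟩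
      obtain ⟨ρ', he⟩ := exists_restrict (h := h) hρ
      exact ⟨ρ', (isRotation_componentEnds_iff he).2 fun s t _ _ => hρ s t,
        (totalBound_componentEnds hx he).2 hl⟩
  rw [← hemb, Nat.lt_succ_iff, Multigraph.genus]
  constructor
  · intro hle
    -- Any rotation is an embedding of some, possibly large, genus. Without this the infimum could
    -- be that of the empty set, which is 0.
    have hne : {g | ((toMultigraph x).induce
      ((toMultigraph x).toSimple.connectedComponentMk (x h)).supp).EmbeddableOn g}.Nonempty :=
      ⟨2 + {e : E | linked x (e, false) h}.ncard,
        hemb.2 ⟨ρ₀, hρ₀, by rw [LocalBound]; omega⟩⟩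
    obtain ⟨R, hR⟩ := Nat.sInf_mem hne
    exact ⟨R, by omega⟩
  · exact fun hg => Nat.sInf_le hg

end Component

theorem forall_component_iff {E V : Type*} {x : E × Bool → V} (hx : x.Surjective)
    {P : (toMultigraph x).toSimple.ConnectedComponent → Prop} :
    (∀ C, P C) ↔ ∀ h, P ((toMultigraph x).toSimple.connectedComponentMk (x h)) := by
  refine ⟨fun h s => h _, fun h C => ?_⟩
  induction C using SimpleGraph.ConnectedComponent.ind with | h v => ?_
  obtain ⟨s, rfl⟩ := hx v
  exact h s

/-! ### Compensation factors by orbit counting. -/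

section Count

variable {E V : Type*} [Fintype E]

theorem toMultigraph_eq_sum [DecidableEq V] (x : E × Bool → V) (e : Sym2 V) :
    toMultigraph x e = ∑ i, if s(x (i, false), x (i, true)) = e then 1 else 0 := by
  rw [toMultigraph, Nat.card_eq_fintype_card, Fintype.card_subtype, Finset.card_filter]

theorem sum_toMultigraph [Fintype V] [DecidableEq V] (x : E × Bool → V) :
    ∑ e, toMultigraph x e = Fintype.card E := by
  simp_rw [toMultigraph_eq_sum]
  rw [Finset.sum_comm]
  simp

theorem degree_toMultigraph [Fintype V] (x : E × Bool → V) (v : V) :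
    (toMultigraph x).degree v = {h | x h = v}.ncard := by
  classical
  have h1 : {h | x h = v}.ncard = ∑ h, if x h = v then 1 else 0 := by
    rw [← Finset.card_filter, ← Set.ncard_coe_finset]
    simp
  rw [Multigraph.degree, h1, Fintype.sum_prod_type]
  simp_rw [toMultigraph_eq_sum]
  rw [Finset.sum_comm, ← Finset.sum_add_distrib]
  refine Finset.sum_congr rfl fun i _ => ?_
  rw [Fintype.sum_bool]
  generalize x (i, false) = a
  generalize x (i, true) = b
  have key : ∀ u, (s(a, b) = s(v, u)) ↔ (a = v ∧ b = u) ∨ (a = u ∧ b = v) := fun u => Sym2.eq_iff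
  simp only [key]
  by_cases ha : a = v
  · subst ha
    by_cases hb : b = a
    · subst hb; simp
    · simp [hb]
  · by_cases hb : b = v
    · subst hb; simp [ha]
    · simp [ha, hb]

/-- The permutations in question form a coset of the stabilizer of `f`, which permutes each fibre
independently. -/
theorem card_perm_comp_eq {ι : Type*} [Fintype ι] (f : E → ι) (τ₀ : Perm E) :
    Nat.card {τ : Perm E // f ∘ τ = f ∘ τ₀} = ∏ i, (Nat.card {a // f a = i}).factorial := by
  classical
  have h := DomMulAct.stabilizer_card f
  simp only [← Nat.card_eq_fintype_card] at h
  rw [← h]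
  refine Nat.card_congr ((Equiv.mulRight τ₀⁻¹).subtypeEquiv fun τ => ?_)
  constructor
  · intro h
    funext a
    simpa using congrFun h (τ₀⁻¹ a)
  · intro h
    funext a
    simpa using congrFun h (τ₀ a)

/-- Once the edges are matched, a non-loop fits in exactly one orientation and a loop in both. -/
theorem card_orientations (x₀ x : E × Bool → V) (τ : Perm E)
    (h : ∀ i, s(x₀ (τ i, false), x₀ (τ i, true)) = s(x (i, false), x (i, true))) :
    Nat.card {b : E → Bool // x₀ ∘ reorient τ b = x} =
      2 ^ Nat.card {i // x (i, false) = x (i, true)} := by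
  classical
  let P : E → Bool → Prop := fun i β => ∀ γ, x₀ (τ i, xor β γ) = x (i, γ)
  have h1 : ∀ b : E → Bool, x₀ ∘ reorient τ b = x ↔ ∀ i, P i (b i) := by
    intro b
    rw [funext_iff, Prod.forall]
    rfl
  have h2 : ∀ i, Nat.card {β // P i β} = if x (i, false) = x (i, true) then 2 else 1 := by
    intro i
    have hP : ∀ β, P i β ↔ x₀ (τ i, β) = x (i, false) ∧ x₀ (τ i, !β) = x (i, true) := by
      intro β
      simp [P, Bool.forall_bool]
    split_ifs with hx
    · have : ∀ β, P i β := by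
        intro β
        have h3 := h i
        rw [hP]
        rw [← hx] at h3 ⊢
        cases β <;> rcases Sym2.eq_iff.1 h3 with ⟨h4, h5⟩ | ⟨h4, h5⟩ <;> simp [h4, h5]
      rw [Nat.card_congr (Equiv.subtypeUnivEquiv this), Nat.card_eq_fintype_card, Fintype.card_bool]
    · rw [Nat.card_eq_one_iff_unique]
      constructor
      · refine ⟨fun ⟨β, hβ⟩ ⟨β', hβ'⟩ => Subtype.ext ?_⟩
        rw [hP] at hβ hβ'
        by_contra hne
        have : (!β) = β' := by revert hne; cases β <;> cases β' <;> simp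
        rw [← this] at hβ'
        exact hx (hβ'.1.symm.trans hβ.2)
      · rcases Sym2.eq_iff.1 (h i) with ⟨h4, h5⟩ | ⟨h4, h5⟩
        · exact ⟨false, (hP _).2 ⟨h4, h5⟩⟩
        · exact ⟨true, (hP _).2 ⟨h5, h4⟩⟩
  have h3 : {b : E → Bool // x₀ ∘ reorient τ b = x} ≃ ∀ i, {β // P i β} :=
    (Equiv.subtypeEquivRight h1).trans Equiv.subtypePiEquivPi
  rw [Nat.card_congr h3, Nat.card_pi]
  simp_rw [h2]
  rw [Finset.prod_ite, Finset.prod_const, Finset.prod_const, one_pow, mul_one,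
    Nat.card_eq_fintype_card, Fintype.card_subtype]

/-- Orbit counting: the number of ways to label and to orient the edges of a multigraph. -/
theorem card_toMultigraph_eq [Fintype V] [DecidableEq V] (x₀ : E × Bool → V) :
    Nat.card {x : E × Bool → V // toMultigraph x = toMultigraph x₀} *
      (2 ^ (∑ v, toMultigraph x₀ s(v, v)) * ∏ e, (toMultigraph x₀ e).factorial) =
    (Fintype.card E).factorial * 2 ^ Fintype.card E := by
  classical
  let F : Perm E × (E → Bool) → {x : E × Bool → V // toMultigraph x = toMultigraph x₀} := fun p =>
    ⟨x₀ ∘ reorient p.1 p.2, toMultigraph_reorient _ _ _⟩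
  let f₀ : E → Sym2 V := fun i => s(x₀ (i, false), x₀ (i, true))
  have hfib : ∀ x, Nat.card {p // F p = x} =
      2 ^ (∑ v, toMultigraph x₀ s(v, v)) * ∏ e, (toMultigraph x₀ e).factorial := by
    rintro ⟨x, hx⟩
    obtain ⟨τ₀, b₀, rfl⟩ := exists_reorient hx
    set x := x₀ ∘ reorient τ₀ b₀ with hxdef
    have hsym : ∀ (τ : Perm E) (b : E → Bool) i, s(x₀ (τ i, false), x₀ (τ i, true)) =
        s((x₀ ∘ reorient τ b) (i, false), (x₀ ∘ reorient τ b) (i, true)) := by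
      intro τ b i
      cases h : b i <;> simp [reorient, h, Sym2.eq_swap]
    -- A fibre of the orbit map splits into the edge permutations respecting unordered ends, which
    -- give the product of factorials, and for each of them the orientations, which give a factor 2
    -- per loop.
    let e : {p // F p = ⟨x, hx⟩} ≃
        Σ τ : {τ : Perm E // f₀ ∘ τ = f₀ ∘ τ₀}, {b : E → Bool // x₀ ∘ reorient τ.1 b = x} :=
      { toFun := fun p => ⟨⟨p.1.1, by
          funext i
          have h : x₀ ∘ reorient p.1.1 p.1.2 = x := congrArg Subtype.val p.2
          exact (hsym p.1.1 p.1.2 i).trans (by rw [h, hxdef, ← hsym τ₀ b₀ i]; rfl)⟩,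
          p.1.2, congrArg Subtype.val p.2⟩
        invFun := fun q => ⟨(q.1.1, q.2.1), Subtype.ext q.2.2⟩
        left_inv := fun p => rfl
        right_inv := fun q => rfl }
    have hloop : Nat.card {i // x (i, false) = x (i, true)} = ∑ v, toMultigraph x₀ s(v, v) := by
      rw [← hx]
      simp_rw [toMultigraph_eq_sum]
      rw [Finset.sum_comm, Nat.card_eq_fintype_card, Fintype.card_subtype, Finset.card_filter]
      refine Finset.sum_congr rfl fun i _ => ?_
      simp only [Sym2.eq_iff, or_self]
      by_cases h : x (i, false) = x (i, true)
      · simp [h]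
      · rw [if_neg h, Finset.sum_eq_zero]
        intro v _
        rw [if_neg]
        rintro ⟨h1, h2⟩
        exact h (h1.trans h2.symm)
    rw [Nat.card_congr e, Nat.card_sigma]
    have : ∀ τ : {τ : Perm E // f₀ ∘ τ = f₀ ∘ τ₀},
        Nat.card {b : E → Bool // x₀ ∘ reorient τ.1 b = x} =
          2 ^ ∑ v, toMultigraph x₀ s(v, v) := by
      intro τ
      rw [card_orientations, hloop]
      intro i
      exact (congrFun τ.2 i).trans (hsym τ₀ b₀ i)
    simp_rw [this]
    rw [Finset.sum_const, Finset.card_univ, ← Nat.card_eq_fintype_card, card_perm_comp_eq,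
      smul_eq_mul, mul_comm]
    rfl
  have htot : Nat.card (Perm E × (E → Bool)) =
      (Fintype.card E).factorial * 2 ^ Fintype.card E := by
    rw [Nat.card_prod, Nat.card_eq_fintype_card, Nat.card_eq_fintype_card, Fintype.card_perm,
      Fintype.card_fun, Fintype.card_bool]
  rw [← htot, ← Nat.card_congr (Equiv.sigmaFiberEquiv F), Nat.card_sigma]
  simp_rw [hfib]
  rw [Finset.sum_const, Finset.card_univ, ← Nat.card_eq_fintype_card, smul_eq_mul]

theorem exists_toMultigraph_eq [Fintype V] [DecidableEq V] {M : Multigraph V}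
    (hM : ∑ e, M e = Fintype.card E) : ∃ x : E × Bool → V, toMultigraph x = M := by
  classical
  have hcard : Fintype.card E = Fintype.card (Σ e, Fin (M e)) := by simp [hM]
  let τ := Fintype.equivOfCardEq hcard
  refine ⟨fun s => if s.2 then (τ s.1).1.out.2 else (τ s.1).1.out.1, ?_⟩
  ext e
  have h1 : ∀ i : E, s((τ i).1.out.1, (τ i).1.out.2) = (τ i).1 := fun i => Quot.out_eq _
  simp only [toMultigraph, Bool.false_eq_true, if_false, if_true, h1]
  rw [Nat.card_congr ((τ.subtypeEquiv (q := fun p => p.1 = e) fun i => Iff.rfl).trans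
    (Equiv.sigmaSubtype e)), Nat.card_eq_fintype_card, Fintype.card_fin]

theorem compensationFactor_toMultigraph [Fintype V] [DecidableEq V] {M : Multigraph V}
    (hM : ∑ e, M e = Fintype.card E) : M.compensationFactor =
      (Nat.card {x : E × Bool → V // toMultigraph x = M} : ℝ) /
        ((Fintype.card E).factorial * 2 ^ Fintype.card E) := by
  obtain ⟨x₀, rfl⟩ := exists_toMultigraph_eq hM
  have h := congrArg (Nat.cast : ℕ → ℝ) (card_toMultigraph_eq x₀)
  push_cast at h
  rw [← h, Multigraph.compensationFactor, Finset.prod_inv_distrib, ← mul_inv]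
  have h0 : (Nat.card {x : E × Bool → V // toMultigraph x = toMultigraph x₀} : ℝ) ≠ 0 := by
    rw [Nat.cast_ne_zero, Nat.card_ne_zero]
    exact ⟨⟨x₀, rfl⟩, inferInstance⟩
  have h1 : (∏ e, ((toMultigraph x₀ e).factorial : ℝ)) ≠ 0 :=
    Finset.prod_ne_zero_iff.2 fun e _ => Nat.cast_ne_zero.2 (Nat.factorial_ne_zero _)
  field_simp

end Count

/-! ### Weights of kernel classes as numbers of half-edge maps. -/

/-- The ends of the edges of the kernels with the given properties. -/
def kernelEnds (E V : Type*) (g : ℕ) (K : ℕ → Prop) (L : Prop) (g' : ℕ) : Set (E × Bool → V) :=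
  {x | (∀ v, 3 ≤ {h | x h = v}.ncard) ∧ Admissible g K L g' x}

theorem surjective_of_ncard {E V : Type*} {x : E × Bool → V}
    (h : ∀ v, 3 ≤ {h | x h = v}.ncard) : x.Surjective := by
  intro v
  have : {h | x h = v}.Nonempty := Set.nonempty_of_ncard_ne_zero (by have := h v; omega)
  exact this

/-- The parameters `K`, `L`, `g'` let one count serve all three classes: `K` restricts the number of
components, and `L` switches on the bound `g'` for the genus of each component. -/
theorem kernelWeightWith_eq {g n m g' : ℕ} {P : Multigraph (Fin n) → Prop} {K : ℕ → Prop} {L : Prop}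
    (hP : ∀ x : Fin m × Bool → Fin n, x.Surjective → (toMultigraph x).EmbeddableOn g →
      (P (toMultigraph x) ↔ K (Nat.card (Quotient (linked x))) ∧
        (L → ∀ h, ∃ ρ, IsRotation x ρ ∧ LocalBound g' x ρ h))) :
    kernelWeightWith g n m P =
      ((kernelEnds (Fin m) (Fin n) g K L g').ncard : ℝ) / (m.factorial * 2 ^ m) := by
  classical
  have hmem : ∀ x : Fin m × Bool → Fin n, x ∈ kernelEnds (Fin m) (Fin n) g K L g' ↔
      toMultigraph x ∈ (kernelClass g n m).filter P := by
    intro x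
    have hsum : ∑ e, toMultigraph x e = m := by rw [sum_toMultigraph, Fintype.card_fin]
    simp only [kernelClass, Finset.mem_filter, Finset.mem_piAntidiag, hsum, degree_toMultigraph,
      Finset.mem_univ, implies_true, and_true, true_and, kernelEnds, Set.mem_ofPred_eq]
    rw [and_assoc]
    refine and_congr_right fun h3 => ?_
    have hx := surjective_of_ncard h3
    rw [Admissible, embeddableOn_toMultigraph hx]
    refine and_congr_right fun hemb => ?_
    rw [hP x hx ((embeddableOn_toMultigraph hx).2 hemb)]
  have hcount : (kernelEnds (Fin m) (Fin n) g K L g').ncard =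
      ∑ M ∈ (kernelClass g n m).filter P,
        Nat.card {x : Fin m × Bool → Fin n // toMultigraph x = M} := by
    have h1 : kernelEnds (Fin m) (Fin n) g K L g' =
        ((Finset.univ.filter fun x : Fin m × Bool → Fin n =>
          toMultigraph x ∈ (kernelClass g n m).filter P : Finset _) : Set _) := by
      ext x
      rw [hmem]
      simp
    have h2 : ∀ x ∈ (Finset.univ.filter fun x : Fin m × Bool → Fin n =>
        toMultigraph x ∈ (kernelClass g n m).filter P : Finset _),
        toMultigraph x ∈ (kernelClass g n m).filter P := fun x hx => (Finset.mem_filter.1 hx).2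
    rw [h1, Set.ncard_coe_finset, Finset.card_eq_sum_card_fiberwise h2]
    refine Finset.sum_congr rfl fun M hM => ?_
    rw [Nat.card_eq_fintype_card, Fintype.card_subtype, Finset.filter_filter]
    congr 1
    ext x
    simp only [Finset.mem_filter_univ]
    exact ⟨fun h => h.2, fun h => ⟨h ▸ hM, h⟩⟩
  rw [hcount, kernelWeightWith, Nat.cast_sum, Finset.sum_div]
  refine Finset.sum_congr (by congr) fun M hM => ?_
  have hM' : ∑ e, M e = Fintype.card (Fin m) := by
    rw [Fintype.card_fin]
    exact (Finset.mem_piAntidiag.1 (Finset.mem_filter.1 (Finset.mem_filter.1 hM).1).1).1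
  rw [compensationFactor_toMultigraph hM', Fintype.card_fin]

theorem kernelWeight_eq (g n m : ℕ) : kernelWeight g n m =
    ((kernelEnds (Fin m) (Fin n) g (fun _ => True) False 0).ncard : ℝ) / (m.factorial * 2 ^ m) := by
  rw [← kernelWeightWith_eq (P := fun _ => True) (by simp)]
  simp [kernelWeight, kernelWeightWith]

theorem kernelWeightWith_hasComponents_eq (g n m k : ℕ) : kernelWeightWith g n m (HasComponents k) =
    ((kernelEnds (Fin m) (Fin n) g (· = k) False 0).ncard : ℝ) / (m.factorial * 2 ^ m) :=
  kernelWeightWith_eq fun x hx _ => by simp [HasComponents, numComponents_toMultigraph hx]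

theorem kernelWeightWith_componentsOfSmallerGenus_eq (g n m : ℕ) :
    kernelWeightWith g n m (ComponentsOfSmallerGenus g) =
    ((kernelEnds (Fin m) (Fin n) g (fun _ => True) (1 ≤ g) (g - 1)).ncard : ℝ) /
      (m.factorial * 2 ^ m) :=
  kernelWeightWith_eq fun x hx hemb => by
    obtain ⟨ρ₀, hρ₀, -⟩ := (embeddableOn_toMultigraph hx).1 hemb
    rw [ComponentsOfSmallerGenus, true_and]
    refine imp_congr_right fun hg => ?_
    obtain ⟨g, rfl⟩ := Nat.exists_eq_add_of_le' hg
    rw [forall_component_iff hx]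
    exact forall_congr' fun h => genus_component_lt_iff hx hρ₀

variable {g g' : ℕ} {K : ℕ → Prop} {L : Prop}

section Relabel

variable {E V E' V' : Type*}

theorem ncard_fiber_comp_vertex (σ : V ≃ V') (x : E × Bool → V) (v : V') :
    {h | (σ ∘ x) h = v}.ncard = {h | x h = σ.symm v}.ncard := by
  simp [Equiv.eq_symm_apply]

theorem ncard_fiber_reorient (τ : E' ≃ E) (b : E' → Bool) (x : E × Bool → V) (v : V) :
    {h | (x ∘ reorient τ b) h = v}.ncard = {h | x h = v}.ncard := by
  rw [← Set.ncard_image_of_injective _ (reorient τ b).injective]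
  congr 1
  ext h
  obtain ⟨h, rfl⟩ := (reorient τ b).surjective h
  simp

theorem comp_vertex_mem_kernelEnds (σ : V ≃ V') {x : E × Bool → V}
    (hx : x ∈ kernelEnds E V g K L g') : σ ∘ x ∈ kernelEnds E V' g K L g' :=
  ⟨fun v => by rw [ncard_fiber_comp_vertex]; exact hx.1 _, hx.2.comp_vertex σ⟩

theorem reorient_mem_kernelEnds (τ : E' ≃ E) (b : E' → Bool) {x : E × Bool → V}
    (hx : x ∈ kernelEnds E V g K L g') : x ∘ reorient τ b ∈ kernelEnds E' V g K L g' :=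
  ⟨fun v => by rw [ncard_fiber_reorient]; exact hx.1 _, hx.2.reorient τ b⟩

end Relabel

/-- The ends of the edges of the kernels of maximum degree at most four. -/
def subquarticEnds (E V : Type*) (g : ℕ) (K : ℕ → Prop) (L : Prop) (g' : ℕ) :
    Set (E × Bool → V) :=
  {x | x ∈ kernelEnds E V g K L g' ∧ ∀ v, {h | x h = v}.ncard ≤ 4}

section Relabel

variable {E V E' V' : Type*}

theorem comp_vertex_mem_subquarticEnds (σ : V ≃ V') {x : E × Bool → V}
    (hx : x ∈ subquarticEnds E V g K L g') : σ ∘ x ∈ subquarticEnds E V' g K L g' :=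
  ⟨comp_vertex_mem_kernelEnds σ hx.1, fun v => by rw [ncard_fiber_comp_vertex]; exact hx.2 _⟩

theorem reorient_mem_subquarticEnds (τ : E' ≃ E) (b : E' → Bool) {x : E × Bool → V}
    (hx : x ∈ subquarticEnds E V g K L g') : x ∘ reorient τ b ∈ subquarticEnds E' V g K L g' :=
  ⟨reorient_mem_kernelEnds τ b hx.1, fun v => by rw [ncard_fiber_reorient]; exact hx.2 _⟩

theorem relabel_injective (σ : V ≃ V') (τ : E' ≃ E) (b : E' → Bool) :
    (fun x : E × Bool → V => σ ∘ x ∘ reorient τ b).Injective := by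
  intro x x' h
  exact (reorient τ b).surjective.injective_comp_right (σ.injective.comp_left h)

theorem ncard_kernelEnds_le [Finite E] [Finite V] [Finite E'] [Finite V'] (σ : V ≃ V') (τ : E' ≃ E) :
    (kernelEnds E V g K L g').ncard ≤ (kernelEnds E' V' g K L g').ncard :=
  Set.ncard_le_ncard_of_injOn (fun x => σ ∘ x ∘ reorient τ fun _ => false)
    (fun _ hx => comp_vertex_mem_kernelEnds σ (reorient_mem_kernelEnds τ _ hx))
    (relabel_injective σ τ _).injOn

theorem ncard_subquarticEnds_le [Finite E] [Finite V] [Finite E'] [Finite V'] (σ : V ≃ V')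
    (τ : E' ≃ E) :
    (subquarticEnds E V g K L g').ncard ≤ (subquarticEnds E' V' g K L g').ncard :=
  Set.ncard_le_ncard_of_injOn (fun x => σ ∘ x ∘ reorient τ fun _ => false)
    (fun _ hx => comp_vertex_mem_subquarticEnds σ (reorient_mem_subquarticEnds τ _ hx))
    (relabel_injective σ τ _).injOn

end Relabel

/-! ### Degrees under contraction. -/

section Collapse

variable {E V : Type*} {y : Option E × Bool → Option V} {x : E × Bool → V}

/-- The contracted kernel is determined by the uncontracted one, so splittings of different kernels
are different. -/
theorem IsCollapse.eq {x' : E × Bool → V} (h : IsCollapse y x) (h' : IsCollapse y x') : x = x' := by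
  obtain ⟨-, u, hu, hx⟩ := h
  obtain ⟨-, u', hu', hx'⟩ := h'
  have : u = u' := Option.some_injective _ (hu.symm.trans hu')
  funext s
  rw [hx, hx', this]

theorem exists_lift_eq {v : Option V} (h : 3 ≤ {s | y s = v}.ncard) : ∃ s, y (lift s) = v := by
  by_contra! hne
  have hsub : {s | y s = v} ⊆ {(none, false), (none, true)} := by
    intro s hs
    rcases cases_halfEdge s with rfl | rfl | ⟨t, rfl⟩
    · simp
    · simp
    · exact absurd hs (hne t)
  have := Set.ncard_le_ncard hsub (by simp)
  rw [Set.ncard_pair (by simp)] at this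
  omega

theorem IsCollapse.ncard_fiber_of_ne (hc : IsCollapse y x) {u v : V}
    (hu : y (none, false) = some u) (hv : v ≠ u) :
    {s | y s = some v}.ncard = {s | x s = v}.ncard := by
  obtain ⟨hb, u', hu', hx⟩ := hc
  obtain rfl : u = u' := Option.some_injective _ (hu.symm.trans hu')
  rw [← Set.ncard_image_of_injective _ (lift_injective (E := E))]
  congr 1
  ext s
  simp only [Set.mem_ofPred_eq, Set.mem_image]
  constructor
  · intro hs
    rcases cases_halfEdge s with rfl | rfl | ⟨t, rfl⟩
    · rw [hu] at hs
      exact absurd (Option.some_injective _ hs).symm hv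
    · rw [hb] at hs; cases hs
    · exact ⟨t, by rw [hx, hs]; rfl, rfl⟩
  · rintro ⟨t, ht, rfl⟩
    rw [hx] at ht
    cases h : y (lift t) with
    | none => rw [h] at ht; exact absurd ht.symm hv
    | some w => rw [h] at ht; rw [← ht]; rfl

/-- The half-edges at `u` are distributed between the two ends, and the new edge adds one half-edge
to each. -/
theorem IsCollapse.ncard_fiber_add [Finite E] (hc : IsCollapse y x) {u : V}
    (hu : y (none, false) = some u) :
    {s | y s = some u}.ncard + {s | y s = none}.ncard = {s | x s = u}.ncard + 2 := by
  obtain ⟨hb, u', hu', hx⟩ := hc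
  obtain rfl : u = u' := Option.some_injective _ (hu.symm.trans hu')
  have h1 : {s | y s = some u} ∪ {s | y s = none} =
      insert (none, false) (insert (none, true) (lift '' {s | x s = u})) := by
    ext s
    simp only [Set.mem_union, Set.mem_ofPred_eq, Set.mem_insert_iff, Set.mem_image]
    rcases cases_halfEdge s with rfl | rfl | ⟨t, rfl⟩
    · simp [hu]
    · simp [hb]
    · simp only [lift_injective.eq_iff, exists_eq_right, hx]
      cases h : y (lift t) <;> simp [lift]
  have h2 : Disjoint {s | y s = some u} {s | y s = none} := by
    rw [Set.disjoint_left]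
    intro s hs hs'
    simp only [Set.mem_ofPred_eq] at hs hs'
    rw [hs] at hs'; cases hs'
  rw [← Set.ncard_union_eq h2, h1, Set.ncard_insert_of_notMem, Set.ncard_insert_of_notMem,
    Set.ncard_image_of_injective _ lift_injective]
  · simp [lift]
  · simp [lift]

theorem collapse_mem_kernelEnds [Finite E] [Finite V] (hc : IsCollapse y x)
    (hy : y ∈ kernelEnds (Option E) (Option V) g K L g') : x ∈ kernelEnds E V g K L g' := by
  classical
  refine ⟨fun v => ?_, hy.2.collapse hc (exists_lift_eq (hy.1 _)) (exists_lift_eq (hy.1 _))⟩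
  obtain ⟨u, hu⟩ : ∃ u, y (none, false) = some u := hc.2.imp fun _ h => h.1
  by_cases hv : v = u
  · subst hv
    have h1 := hc.ncard_fiber_add hu
    have h2 := hy.1 none
    have h3 := hy.1 (some v)
    omega
  · rw [← hc.ncard_fiber_of_ne hu hv]
    exact hy.1 _

end Collapse

/-! ### Upper bound: splitting vertices. -/

section Split

variable {E V : Type*}

theorem three_le_ncard {α : Type*} [Finite α] {S : Set α} {a b c : α} (ha : a ∈ S) (hb : b ∈ S)
    (hc : c ∈ S) (hab : a ≠ b) (hac : a ≠ c) (hbc : b ≠ c) : 3 ≤ S.ncard := by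
  have h : ({a, b, c} : Set α) ⊆ S := by
    rintro s (rfl | rfl | rfl) <;> assumption
  have h3 : ({a, b, c} : Set α).ncard = 3 := Set.ncard_eq_three.2 ⟨a, b, c, hab, hac, hbc, rfl⟩
  rw [← h3]
  exact Set.ncard_le_ncard h

/-- The pairs of half-edges along which a vertex can be split into two vertices of degree at least
three. -/
def splitPairs (x : E × Bool → V) (ρ : Perm (E × Bool)) : Set ((E × Bool) × (E × Bool)) :=
  {p | p.1 ≠ p.2 ∧ x p.1 = x p.2 ∧ ρ.symm p.2 ≠ p.1 ∧ ρ.symm p.1 ≠ p.2}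

/-- A single rotation is fixed for the kernel, so that different pairs give different splittings; it
witnesses all genus bounds, so that every splitting inherits them. -/
theorem exists_splittings [Finite E] [Finite V] {x : E × Bool → V} (hx : x ∈ kernelEnds E V g K L g') :
    ∃ ρ : Perm (E × Bool), ∃ F : (E × Bool) × (E × Bool) → (Option E × Bool → Option V),
      Set.InjOn F (splitPairs x ρ) ∧ ∀ p ∈ splitPairs x ρ,
        IsCollapse (F p) x ∧ F p ∈ kernelEnds (Option E) (Option V) g K L g' := by
  classical
  obtain ⟨ρ, hρ, ht, hl⟩ := hx.2.exists_rotation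
  have key : ∀ p : (E × Bool) × (E × Bool), ∃ y : Option E × Bool → Option V,
      p ∈ splitPairs x ρ → (IsCollapse y x ∧ y ∈ kernelEnds (Option E) (Option V) g K L g' ∧
      y (lift p.1) = none ∧ y (lift (ρ.symm p.2)) = none ∧ y (lift p.2) ≠ none ∧
      y (lift (ρ.symm p.1)) ≠ none ∧
      ∀ s, s ≠ p.1 → s ≠ p.2 → y (lift (ρ.symm s)) = y (lift s)) := by
    rintro ⟨h, t⟩
    by_cases hp : (h, t) ∈ splitPairs x ρ
    swap
    · exact ⟨fun _ => none, fun h => absurd h hp⟩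
    obtain ⟨h1, h2, h3, h4⟩ := hp
    obtain ⟨y, ρ', hc, hρ', hcol, ya, yh, yt', yt, yh', ys⟩ := exists_split hρ h1 h2
    refine ⟨y, fun _ => ⟨hc, ⟨?_, ?_⟩, yh, yt', by simp [yt], by simp [yh'], ys⟩⟩
    · intro v
      cases v with
      | none =>
        exact three_le_ncard (a := (none, true)) hc.1 yh yt' (by simp [lift]) (by simp [lift])
          (lift_injective.ne h3.symm)
      | some v =>
        by_cases hv : v = x h
        · subst hv
          exact three_le_ncard (a := (none, false)) ya yt yh' (by simp [lift]) (by simp [lift])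
            (lift_injective.ne h4.symm)
        · rw [hc.ncard_fiber_of_ne ya hv]
          exact hx.1 v
    · exact hx.2.of_collapse hc ⟨t, yt.trans ya.symm⟩ ⟨h, yh.trans hc.1.symm⟩ hρ' (hcol ▸ ht)
        (hcol ▸ hl)
  choose F hF using key
  refine ⟨ρ, F, ?_, fun p hp => ⟨(hF p hp).1, (hF p hp).2.1⟩⟩
  rintro p hp q hq hpq
  obtain ⟨-, -, p1, p2, p3, p4, p5⟩ := hF p hp
  obtain ⟨-, -, q1, q2, q3, q4, q5⟩ := hF q hq
  rw [← hpq] at q1 q2 q3 q4 q5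
  -- The pair can be read off the splitting: `p.1` is the only half-edge that moves to the new
  -- vertex while its predecessor under `ρ` stays, and `p.2` the only one that stays while its
  -- predecessor moves.
  refine Prod.ext ?_ ?_
  · by_contra hne
    have h1 : p.1 ≠ q.2 := fun h => q3 (h ▸ p1)
    exact p4 ((q5 _ hne h1).trans p1)
  · by_contra hne
    have h1 : p.2 ≠ q.1 := fun h => p3 (h ▸ q1)
    exact p3 ((q5 _ h1 hne).symm.trans p2)

theorem sum_ncard_fiber [Fintype E] [Fintype V] (x : E × Bool → V) :
    ∑ v, {h | x h = v}.ncard = 2 * Fintype.card E := by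
  classical
  have h1 := Finset.card_eq_sum_card_fiberwise (f := x) (s := Finset.univ) (t := Finset.univ)
    fun _ _ => Finset.mem_univ _
  rw [Finset.card_univ, Fintype.card_prod, Fintype.card_bool, mul_comm] at h1
  rw [h1]
  refine Finset.sum_congr rfl fun v _ => ?_
  rw [← Set.ncard_coe_finset]
  simp

/-- At a vertex of degree D, each half-edge has at least D - 3 partners, namely all but itself and
its two neighbours in the rotation. Writing D = 3 + a with the a summing to d, the sum of D(D-3) is
3d plus the sum of a², which by Cauchy-Schwarz is at least 3d + d²/|V| = 2|E|d/|V|. -/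
theorem le_ncard_splitPairs [Fintype E] [Fintype V] {x : E × Bool → V}
    (hx : ∀ v, 3 ≤ {h | x h = v}.ncard) (ρ : Perm (E × Bool)) {d : ℕ}
    (hd : 2 * Fintype.card E = 3 * Fintype.card V + d) :
    2 * Fintype.card E * d ≤ Fintype.card V * (splitPairs x ρ).ncard := by
  classical
  set D : V → ℕ := fun v => {h | x h = v}.ncard with hD
  have h1 : ∑ v, D v * (D v - 3) ≤ (splitPairs x ρ).ncard := by
    have h2 : ∑ v, D v * (D v - 3) = ∑ h, (D (x h) - 3) := by
      rw [← Finset.sum_fiberwise' (Finset.univ : Finset (E × Bool)) x fun v => D v - 3]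
      refine Finset.sum_congr rfl fun v _ => ?_
      rw [Finset.sum_const, smul_eq_mul, ← Set.ncard_coe_finset]
      simp [hD]
    have h3 : splitPairs x ρ = (((Finset.univ : Finset (E × Bool)).sigma fun h =>
        (Finset.univ.filter (x · = x h)) \ {h, ρ h, ρ.symm h}).map
          (Equiv.sigmaEquivProd _ _).toEmbedding : Finset _) := by
      ext ⟨h, t⟩
      simp only [splitPairs, Set.mem_ofPred_eq, Finset.coe_map, Set.mem_image, Finset.mem_coe,
        Finset.mem_sigma, Finset.mem_univ, true_and, Finset.mem_sdiff, Finset.mem_filter,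
        Finset.mem_insert, Finset.mem_singleton, not_or, Equiv.coe_toEmbedding]
      constructor
      · rintro ⟨h1, h2, h3, h4⟩
        exact ⟨⟨h, t⟩, ⟨h2.symm, Ne.symm h1, fun h => h3 (by rw [show t = ρ _ from h, ρ.symm_apply_apply]), Ne.symm h4⟩, rfl⟩
      · rintro ⟨⟨h', t'⟩, ⟨h1, h2, h3, h4⟩, he⟩
        obtain ⟨rfl, rfl⟩ := Prod.mk.inj he
        exact ⟨Ne.symm h2, h1.symm, fun h => h3 (by rw [← h, ρ.apply_symm_apply]), Ne.symm h4⟩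
    rw [h2, h3, Set.ncard_coe_finset, Finset.card_map, Finset.card_sigma]
    refine Finset.sum_le_sum fun h _ => ?_
    refine le_trans ?_ (Finset.le_card_sdiff _ _)
    have h4 : (Finset.univ.filter (x · = x h)).card = D (x h) := by
      rw [← Set.ncard_coe_finset]; simp [hD]
    rw [h4]
    exact Nat.sub_le_sub_left Finset.card_le_three _
  refine le_trans ?_ (Nat.mul_le_mul_left _ h1)
  choose a ha using fun v => Nat.exists_eq_add_of_le (hx v)
  have haD : ∀ v, D v = 3 + a v := ha
  have hsum : ∑ v, a v = d := by
    have := sum_ncard_fiber x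
    simp_rw [ha] at this
    rw [Finset.sum_add_distrib, Finset.sum_const, Finset.card_univ, smul_eq_mul] at this
    omega
  have hsq : d ^ 2 ≤ Fintype.card V * ∑ v, a v ^ 2 := by
    rw [← hsum]
    exact sq_sum_le_card_mul_sum_sq
  have : ∑ v, D v * (D v - 3) = 3 * d + ∑ v, a v ^ 2 := by
    rw [← hsum, Finset.mul_sum, ← Finset.sum_add_distrib]
    refine Finset.sum_congr rfl fun v _ => ?_
    rw [haD, Nat.add_sub_cancel_left]
    ring
  rw [this, hd]
  nlinarith

/-- Splitting a vertex of a kernel in all possible ways. -/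
theorem ncard_kernelEnds_mul_le [Fintype E] [Fintype V] {d : ℕ}
    (hd : 2 * Fintype.card E = 3 * Fintype.card V + d) :
    (kernelEnds E V g K L g').ncard * (2 * Fintype.card E * d) ≤
      (kernelEnds (Option E) (Option V) g K L g').ncard := by
  classical
  have key := fun x : kernelEnds E V g K L g' => exists_splittings x.2
  choose ρ F hinj hF using key
  let I := Σ x : kernelEnds E V g K L g', splitPairs x.1 (ρ x)
  -- The last coordinate is the label given to the new vertex; it is recovered as the second end of
  -- the last edge.
  let Φ : I × Option V → kernelEnds (Option E) (Option V) g K L g' := fun q =>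
    ⟨swap none q.2 ∘ F q.1.1 q.1.2, comp_vertex_mem_kernelEnds _ (hF _ _ q.1.2.2).2⟩
  have hΦ : Φ.Injective := by
    rintro ⟨⟨x, p⟩, w⟩ ⟨⟨x', p'⟩, w'⟩ h
    have h1 : swap none w ∘ F x p = swap none w' ∘ F x' p' := congrArg Subtype.val h
    have hw : w = w' := by
      have := congrFun h1 (none, true)
      simpa [(hF x p p.2).1.1, (hF x' p' p'.2).1.1] using this
    subst hw
    have h2 : F x p = F x' p' := (swap none w).injective.comp_left h1
    have hxx : x = x' := Subtype.ext ((hF x p p.2).1.eq (h2 ▸ (hF x' p' p'.2).1))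
    subst hxx
    have hpp : p = p' := Subtype.ext (hinj x p.2 p'.2 h2)
    subst hpp
    rfl
  have hcard := Nat.card_le_card_of_injective Φ hΦ
  rw [Nat.card_prod, Nat.card_sigma, Finite.card_option, Nat.card_coe_set_eq,
    Nat.card_eq_fintype_card] at hcard
  refine le_trans ?_ hcard
  have h1 : ∀ x : kernelEnds E V g K L g', 2 * Fintype.card E * d ≤
      Nat.card (splitPairs x.1 (ρ x)) * Fintype.card V := fun x => by
    rw [mul_comm, mul_comm d, mul_comm _ (Fintype.card V), Nat.card_coe_set_eq]
    exact le_ncard_splitPairs x.2.1 (ρ x) hd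
  calc (kernelEnds E V g K L g').ncard * (2 * Fintype.card E * d)
      = ∑ _x : kernelEnds E V g K L g', 2 * Fintype.card E * d := by
        rw [Finset.sum_const, Finset.card_univ, smul_eq_mul, ← Nat.card_coe_set_eq,
          Nat.card_eq_fintype_card (α := kernelEnds E V g K L g')]
    _ ≤ ∑ x : kernelEnds E V g K L g', Nat.card (splitPairs x.1 (ρ x)) * Fintype.card V :=
        Finset.sum_le_sum fun x _ => h1 x
    _ ≤ _ := by
        rw [← Finset.sum_mul]
        -- There are |V| + 1 labels for the new vertex, of which |V| suffice to cancel the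
        -- denominator from Cauchy-Schwarz.
        exact Nat.mul_le_mul_left _ (Nat.le_succ _)

end Split

/-! ### Lower bound: contracting edges between cubic vertices. -/

variable {g g' : ℕ} {K : ℕ → Prop} {L : Prop} {E V : Type*} [Fintype E] [Fintype V]

theorem ncard_quartic {x : E × Bool → V} (h3 : ∀ v, 3 ≤ {h | x h = v}.ncard)
    (h4 : ∀ v, {h | x h = v}.ncard ≤ 4) {d : ℕ}
    (hd : 2 * Fintype.card E = 3 * Fintype.card V + d) :
    {v | {h | x h = v}.ncard = 4}.ncard = d := by
  classical
  have h1 : ∀ v, {h | x h = v}.ncard = 3 + if {h | x h = v}.ncard = 4 then 1 else 0 := by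
    intro v
    have := h3 v
    have := h4 v
    split_ifs <;> omega
  have h2 := sum_ncard_fiber x
  rw [Finset.sum_congr rfl fun v _ => h1 v, Finset.sum_add_distrib, Finset.sum_const,
    Finset.card_univ, smul_eq_mul, ← Finset.card_filter] at h2
  have h5 : {v | {h | x h = v}.ncard = 4} =
      (Finset.univ.filter fun v => {h | x h = v}.ncard = 4 : Finset V) := by simp
  rw [h5, Set.ncard_coe_finset]
  omega

theorem edgeFlip_edgeFlip {E : Type*} (s : E × Bool) : edgeFlip E (edgeFlip E s) = s := by
  obtain ⟨e, b⟩ := s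
  simp

/-- The half-edges whose edge joins two different cubic vertices. -/
def cubicHalfEdges (x : E × Bool → V) : Set (E × Bool) :=
  {h | x h ≠ x (edgeFlip E h) ∧ {h' | x h' = x h}.ncard = 3 ∧
    {h' | x h' = x (edgeFlip E h)}.ncard = 3}

/-- If all edges at a vertex were loops, its degree would be even. -/
theorem exists_link_of_cubic {E V : Type*} {x : E × Bool → V} {v : V} (hv : {h | x h = v}.ncard = 3) :
    ∃ h, x h = v ∧ x (edgeFlip E h) ≠ v := by
  by_contra! hne
  have h1 : {h | x h = v} = {e | x (e, false) = v} ×ˢ (Set.univ : Set Bool) := by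
    ext ⟨e, b⟩
    cases b
    · simp
    · simp only [Set.mem_ofPred_eq, Set.mem_prod, Set.mem_univ, and_true]
      exact ⟨fun h => hne (e, true) h, fun h => hne (e, false) h⟩
  rw [h1, Set.ncard_prod, Set.ncard_univ, Nat.card_eq_fintype_card, Fintype.card_bool] at hv
  omega

/-- Each of the |V| - d cubic vertices has a half-edge leading to another vertex. At most 4d of
these half-edges can lead to one of the d quartic vertices; the others lead to cubic vertices. -/
theorem card_le_ncard_cubicHalfEdges {x : E × Bool → V} (h3 : ∀ v, 3 ≤ {h | x h = v}.ncard)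
    (h4 : ∀ v, {h | x h = v}.ncard ≤ 4) {d : ℕ}
    (hd : 2 * Fintype.card E = 3 * Fintype.card V + d) :
    Fintype.card V ≤ (cubicHalfEdges x).ncard + 5 * d := by
  classical
  have hq := ncard_quartic h3 h4 hd
  have hc : {v | {h | x h = v}.ncard = 3}.ncard + d = Fintype.card V := by
    rw [← hq, ← Nat.card_eq_fintype_card, ← Set.ncard_add_ncard_compl {v | {h | x h = v}.ncard = 4},
      add_comm]
    congr 2
    ext v
    have := h3 v
    have := h4 v
    simp only [Set.mem_ofPred_eq, Set.mem_compl_iff]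
    omega
  have hH : {h | {h' | x h' = x h}.ncard = 4}.ncard = 4 * d := by
    have h5 : {h | {h' | x h' = x h}.ncard = 4} =
        (Finset.univ.filter fun h => {h' | x h' = x h}.ncard = 4 : Finset (E × Bool)) := by simp
    have h6 : ∀ h ∈ Finset.univ.filter fun h => {h' | x h' = x h}.ncard = 4,
        x h ∈ Finset.univ.filter fun v => {h' | x h' = v}.ncard = 4 := by simp
    rw [h5, Set.ncard_coe_finset, Finset.card_eq_sum_card_fiberwise h6, ← hq]
    have h7 : {v | {h | x h = v}.ncard = 4} =
        (Finset.univ.filter fun v => {h | x h = v}.ncard = 4 : Finset V) := by simp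
    rw [h7, Set.ncard_coe_finset, mul_comm, ← smul_eq_mul, ← Finset.sum_const]
    refine Finset.sum_congr rfl fun v hv => ?_
    rw [← (Finset.mem_filter.1 hv).2, ← Set.ncard_coe_finset]
    congr 1
    ext h
    simp only [Finset.coe_filter, Finset.mem_univ, true_and, Set.mem_ofPred_eq, Finset.mem_filter]
    exact ⟨fun h => h.2, fun h => ⟨by rw [h], h⟩⟩
  choose H hH1 hH2 using fun v : {v | {h | x h = v}.ncard = 3} => exists_link_of_cubic v.2
  have hle : {v | {h | x h = v}.ncard = 3}.ncard ≤
      (cubicHalfEdges x ∪ edgeFlip E '' {h | {h' | x h' = x h}.ncard = 4}).ncard := by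
    rw [← Nat.card_coe_set_eq, ← Nat.card_coe_set_eq]
    refine Nat.card_le_card_of_injective (fun v => ⟨H v, ?_⟩) fun v w h => ?_
    · by_cases h' : {h' | x h' = x (edgeFlip E (H v))}.ncard = 3
      · exact Or.inl ⟨by rw [hH1]; exact (hH2 v).symm, by rw [hH1]; exact v.2, h'⟩
      · refine Or.inr ⟨edgeFlip E (H v), ?_, edgeFlip_edgeFlip _⟩
        have := h3 (x (edgeFlip E (H v)))
        have := h4 (x (edgeFlip E (H v)))
        change _ = 4
        omega
    · apply Subtype.ext
      have h' : H v = H w := congrArg Subtype.val h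
      rw [← hH1 v, ← hH1 w, h']
  have hun := Set.ncard_union_le (cubicHalfEdges x) (edgeFlip E '' {h | {h' | x h' = x h}.ncard = 4})
  rw [Set.ncard_image_of_injective _ (edgeFlip E).injective, hH] at hun
  omega

/-- The subquartic kernels whose last edge joins a cubic vertex to the last vertex, which is cubic
as well. -/
def contractibleEnds (E V : Type*) (g : ℕ) (K : ℕ → Prop) (L : Prop) (g' : ℕ) :
    Set (Option E × Bool → Option V) :=
  {z | z ∈ subquarticEnds (Option E) (Option V) g K L g' ∧ z (none, true) = none ∧
    z (none, false) ≠ none ∧ {h | z h = none}.ncard = 3 ∧ {h | z h = z (none, false)}.ncard = 3}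

/-- A kernel with a chosen half-edge is normalised by making that half-edge `(none, false)` and its
far end the vertex `none`. The normalisation is undone by remembering the half-edge, 2(|E| + 1)
choices, and the far end, |V| + 1 choices. -/
theorem sum_ncard_cubicHalfEdges_le {ι : Type*} [Fintype ι]
    (Y : ι ≃ subquarticEnds (Option E) (Option V) g K L g') :
    ∑ i, (cubicHalfEdges (Y i).1).ncard ≤
      2 * (Fintype.card E + 1) * ((Fintype.card V + 1) * (contractibleEnds E V g K L g').ncard) := by
  classical
  -- All edges are reversed at once when the chosen half-edge is the second half of its edge.
  let z : (Σ i, cubicHalfEdges (Y i).1) → (Option E × Bool → Option V) := fun p =>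
    swap none ((Y p.1).1 (edgeFlip _ p.2.1)) ∘ (Y p.1).1 ∘
      reorient (swap none p.2.1.1) fun _ => p.2.1.2
  have hr1 : ∀ h : Option E × Bool, reorient (swap none h.1) (fun _ => h.2) (none, true) =
      edgeFlip _ h := by
    rintro ⟨e, b⟩
    simp [reorient]
  have hr0 : ∀ h : Option E × Bool, reorient (swap none h.1) (fun _ => h.2) (none, false) = h := by
    rintro ⟨e, b⟩
    simp [reorient]
  have hz1 : ∀ p, z p (none, true) = none := fun p => by
    simp only [z, Function.comp_apply]
    rw [hr1, swap_apply_right]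
  have hz0 : ∀ p, z p (none, false) = swap none ((Y p.1).1 (edgeFlip _ p.2.1)) ((Y p.1).1 p.2.1) :=
    fun p => by
      simp only [z, Function.comp_apply]
      rw [hr0]
  have hfib : ∀ p v, {h | z p h = v}.ncard =
      {h | (Y p.1).1 h = swap none ((Y p.1).1 (edgeFlip _ p.2.1)) v}.ncard := by
    intro p v
    rw [ncard_fiber_comp_vertex, ncard_fiber_reorient, symm_swap]
  have hz : ∀ p, z p ∈ contractibleEnds E V g K L g' := by
    intro p
    obtain ⟨h1, h2, h3⟩ := p.2.2
    refine ⟨comp_vertex_mem_subquarticEnds _ (reorient_mem_subquarticEnds _ _ (Y p.1).2), hz1 p, ?_,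
      ?_, ?_⟩
    · rw [hz0]
      intro h
      rw [swap_apply_eq_iff, swap_apply_left] at h
      exact h1 h
    · rw [hfib, swap_apply_left]
      exact h3
    · rw [hfib, hz0, swap_apply_self]
      exact h2
  let Φ : (Σ i, cubicHalfEdges (Y i).1) →
      (Option E × Bool) × Option V × contractibleEnds E V g K L g' := fun p =>
    (p.2.1, (Y p.1).1 (edgeFlip _ p.2.1), ⟨z p, hz p⟩)
  have hΦ : Φ.Injective := by
    rintro ⟨i, h, hh⟩ ⟨i', h', hh'⟩ he
    obtain ⟨h1, h2⟩ := Prod.mk.inj he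
    obtain ⟨h2, h3⟩ := Prod.mk.inj h2
    simp only at h1 h2
    subst h1
    have h4 : z ⟨i, h, hh⟩ = z ⟨i', h, hh'⟩ := Subtype.ext_iff.1 h3
    simp only [z, ← h2] at h4
    have h5 : (Y i).1 = (Y i').1 := relabel_injective _ _ _ h4
    have h6 : i = i' := Y.injective (Subtype.ext h5)
    subst h6
    rfl
  have := Nat.card_le_card_of_injective Φ hΦ
  rw [Nat.card_sigma, Nat.card_prod, Nat.card_prod, Nat.card_prod, Finite.card_option,
    Finite.card_option, Nat.card_coe_set_eq, Nat.card_eq_fintype_card, Nat.card_eq_fintype_card,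
    Nat.card_eq_fintype_card, Fintype.card_bool, mul_comm (_ + 1) 2] at this
  simpa only [Nat.card_coe_set_eq] using this

/-- Contracting the last edge leaves a quartic vertex. The kernel before contraction is determined
by the contracted one, this vertex (d choices) and the set of half-edges there that belonged to
`none` (2^4 = 16 choices, not only those of the right size). Here d is the excess after the
contraction. -/
theorem ncard_contractibleEnds_le {d : ℕ} (hd : 2 * Fintype.card E = 3 * Fintype.card V + d) :
    (contractibleEnds E V g K L g').ncard ≤ 16 * d * (subquarticEnds E V g K L g').ncard := by
  classical
  let T := Σ x : subquarticEnds E V g K L g', Σ u : {v | {h | x.1 h = v}.ncard = 4},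
    Set {h | x.1 h = u.1}
  -- Reconstruction from the recorded data. Its values need not be contractible kernels; only that
  -- every such kernel is a value matters.
  let R : T → (Option E × Bool → Option V) := fun p s => match s with
    | (none, true) => none
    | (none, false) => some p.2.1.1
    | (some e, b) => if ∃ h : p.1.1 (e, b) = p.2.1.1, (⟨(e, b), h⟩ : {h | p.1.1 h = p.2.1.1}) ∈ p.2.2
      then none else some (p.1.1 (e, b))
  have hR1 : ∀ (p : T) e b, (∃ h : p.1.1 (e, b) = p.2.1.1,
      (⟨(e, b), h⟩ : {h | p.1.1 h = p.2.1.1}) ∈ p.2.2) → R p (lift (e, b)) = none :=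
    fun p e b h => if_pos h
  have hR2 : ∀ (p : T) e b, (¬ ∃ h : p.1.1 (e, b) = p.2.1.1,
      (⟨(e, b), h⟩ : {h | p.1.1 h = p.2.1.1}) ∈ p.2.2) → R p (lift (e, b)) = some (p.1.1 (e, b)) :=
    fun p e b h => if_neg h
  have hT : Nat.card T = 16 * d * (subquarticEnds E V g K L g').ncard := by
    rw [Nat.card_sigma]
    have h1 : ∀ x : subquarticEnds E V g K L g', Nat.card (Σ u : {v | {h | x.1 h = v}.ncard = 4},
        Set {h | x.1 h = u.1}) = 16 * d := by
      intro x
      rw [Nat.card_sigma]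
      have h2 : ∀ u : {v | {h | x.1 h = v}.ncard = 4}, Nat.card (Set {h | x.1 h = u.1}) = 16 := by
        intro u
        rw [Nat.card_eq_fintype_card, Fintype.card_set, ← Nat.card_eq_fintype_card,
          Nat.card_coe_set_eq, u.2]
        norm_num
      simp_rw [h2]
      rw [Finset.sum_const, Finset.card_univ, ← Nat.card_eq_fintype_card, Nat.card_coe_set_eq,
        ncard_quartic x.2.1.1 x.2.2 hd, smul_eq_mul, mul_comm]
    simp_rw [h1]
    rw [Finset.sum_const, Finset.card_univ, ← Nat.card_eq_fintype_card, Nat.card_coe_set_eq,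
      smul_eq_mul, mul_comm]
  have hsub : contractibleEnds E V g K L g' ⊆ Set.range R := by
    rintro z ⟨hz, hb, ha, h3, h3'⟩
    obtain ⟨u, hu⟩ := Option.ne_none_iff_exists'.1 ha
    let x : E × Bool → V := fun s => (z (lift s)).getD u
    have hc : IsCollapse z x := ⟨hb, u, hu, fun s => rfl⟩
    have hu4 : {h | x h = u}.ncard = 4 := by
      have := hc.ncard_fiber_add hu
      rw [← hu] at this
      rw [hu] at h3' this
      omega
    have hx : x ∈ subquarticEnds E V g K L g' := by
      refine ⟨collapse_mem_kernelEnds hc hz.1, fun v => ?_⟩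
      by_cases hv : v = u
      · rw [hv, hu4]
      · rw [← hc.ncard_fiber_of_ne hu hv]
        exact hz.2 _
    refine ⟨⟨⟨x, hx⟩, ⟨u, hu4⟩, {s | z (lift s.1) = none}⟩, ?_⟩
    funext s
    rcases cases_halfEdge s with rfl | rfl | ⟨⟨e, b⟩, rfl⟩
    · exact hu.symm
    · exact hb.symm
    · cases h : z (lift (e, b)) with
      | none => exact hR1 _ e b ⟨by simp only [x, h, Option.getD_none], h⟩
      | some v =>
        refine (hR2 _ e b fun h' => ?_).trans (by simp only [x, h, Option.getD_some])
        exact Option.some_ne_none v (h.symm.trans h'.2)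
  calc (contractibleEnds E V g K L g').ncard ≤ (Set.range R).ncard := Set.ncard_le_ncard hsub
    _ ≤ Nat.card T := by
        rw [← Nat.card_coe_set_eq]
        exact Finite.card_range_le R
    _ = _ := hT

/-- Contracting an edge between cubic vertices in all possible ways. -/
theorem ncard_subquarticEnds_mul_le {d : ℕ}
    (hd : 2 * (Fintype.card E + 1) = 3 * (Fintype.card V + 1) + d) :
    (subquarticEnds (Option E) (Option V) g K L g').ncard * (Fintype.card V + 1 - 5 * d) ≤
      2 * (Fintype.card E + 1) * ((Fintype.card V + 1) *
        (16 * (d + 1) * (subquarticEnds E V g K L g').ncard)) := by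
  classical
  have h1 := sum_ncard_cubicHalfEdges_le
    (Equiv.refl (subquarticEnds (Option E) (Option V) g K L g'))
  -- Losing one edge and one vertex raises the excess 2|E| - 3|V| by one.
  have h2 := ncard_contractibleEnds_le (E := E) (V := V) (g := g) (K := K) (L := L) (g' := g')
    (d := d + 1) (by omega)
  refine le_trans ?_ (h1.trans (Nat.mul_le_mul_left _ (Nat.mul_le_mul_left _ h2)))
  rw [← Nat.card_coe_set_eq, Nat.card_eq_fintype_card, ← Finset.card_univ, ← smul_eq_mul,
    ← Finset.sum_const]
  refine Finset.sum_le_sum fun y _ => ?_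
  have := card_le_ncard_cubicHalfEdges y.2.1.1 y.2.2 (d := d) (by simpa using hd)
  rw [Fintype.card_option] at this
  change _ ≤ (cubicHalfEdges y.1).ncard
  omega

/-! ### Ratios of weights and iteration. -/

variable {g g' : ℕ} {K : ℕ → Prop} {L : Prop}

theorem kernelEnds_weight_succ_le {l d : ℕ} (hl : 1 ≤ l) (hd : d + 1 ≤ 2 * l) :
    ((kernelEnds (Fin (3 * l - (d + 1))) (Fin (2 * l - (d + 1))) g K L g').ncard : ℝ) /
        ((3 * l - (d + 1)).factorial * 2 ^ (3 * l - (d + 1))) ≤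
      6 / (d + 1) * (((kernelEnds (Fin (3 * l - d)) (Fin (2 * l - d)) g K L g').ncard : ℝ) /
        ((3 * l - d).factorial * 2 ^ (3 * l - d))) := by
  obtain ⟨n, hn⟩ : ∃ n, n = 2 * l - (d + 1) := ⟨_, rfl⟩
  obtain ⟨m, hm⟩ : ∃ m, m = 3 * l - (d + 1) := ⟨_, rfl⟩
  have hn' : 2 * l - d = n + 1 := by omega
  have hm' : 3 * l - d = m + 1 := by omega
  have hm1 : 1 ≤ m := by omega
  rw [hn', hm', ← hn, ← hm]
  have h1 := ncard_kernelEnds_mul_le (E := Fin m) (V := Fin n) (g := g) (K := K) (L := L) (g' := g')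
    (d := d + 1) (by simp only [Fintype.card_fin]; omega)
  rw [Fintype.card_fin] at h1
  have h2 := h1.trans (ncard_kernelEnds_le (finSuccEquiv n).symm (finSuccEquiv m))
  have h3 : ((kernelEnds (Fin m) (Fin n) g K L g').ncard : ℝ) * (2 * m * (d + 1)) ≤
      (kernelEnds (Fin (m + 1)) (Fin (n + 1)) g K L g').ncard := by exact_mod_cast h2
  set a : ℝ := ((kernelEnds (Fin m) (Fin n) g K L g').ncard : ℝ)
  set b : ℝ := ((kernelEnds (Fin (m + 1)) (Fin (n + 1)) g K L g').ncard : ℝ)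
  have ha : 0 ≤ a := Nat.cast_nonneg _
  have hf : (0 : ℝ) < m.factorial := Nat.cast_pos.2 (Nat.factorial_pos m)
  have hm1' : (1 : ℝ) ≤ m := Nat.one_le_cast.2 hm1
  have hm0 : (0 : ℝ) < m + 1 := by positivity
  have hd0 : (0 : ℝ) < d + 1 := by positivity
  rw [Nat.factorial_succ, pow_succ]
  push_cast
  -- Normalising by m! 2^m costs a factor 2(m + 1), and m + 1 ≤ 2m. The argument gives 2/(d + 1);
  -- the factor 3 is slack.
  have h4 : a * ((m + 1) * (d + 1)) ≤ 3 * b := by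
    have : a * ((m + 1) * (d + 1)) ≤ a * (2 * m * (d + 1)) := by
      refine mul_le_mul_of_nonneg_left ?_ ha
      exact mul_le_mul_of_nonneg_right (by linarith) hd0.le
    have hb : 0 ≤ b := Nat.cast_nonneg _
    linarith
  rw [div_mul_div_comm, div_le_div_iff₀ (by positivity) (by positivity)]
  have h5 : 0 ≤ (m.factorial : ℝ) * 2 ^ m := by positivity
  nlinarith [mul_le_mul_of_nonneg_right h4 h5]

theorem kernelEnds_weight_le {l d : ℕ} (hl : 1 ≤ l) (hd : d ≤ 2 * l) :
    ((kernelEnds (Fin (3 * l - d)) (Fin (2 * l - d)) g K L g').ncard : ℝ) /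
        ((3 * l - d).factorial * 2 ^ (3 * l - d)) ≤
      6 ^ d / d.factorial * (((kernelEnds (Fin (3 * l)) (Fin (2 * l)) g K L g').ncard : ℝ) /
        ((3 * l).factorial * 2 ^ (3 * l))) := by
  induction d with
  | zero => simp
  | succ d ih =>
    refine (kernelEnds_weight_succ_le hl hd).trans ?_
    refine (mul_le_mul_of_nonneg_left (ih (by omega)) (by positivity)).trans (le_of_eq ?_)
    rw [Nat.factorial_succ, pow_succ, ← mul_assoc]
    congr 1
    push_cast
    have : (d.factorial : ℝ) ≠ 0 := Nat.cast_ne_zero.2 (Nat.factorial_ne_zero d)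
    field_simp

theorem subquarticEnds_weight_succ_ge {l d : ℕ} (hd : 7 * (d + 1) ≤ 2 * l) :
    ((subquarticEnds (Fin (3 * l - d)) (Fin (2 * l - d)) g K L g').ncard : ℝ) /
        ((3 * l - d).factorial * 2 ^ (3 * l - d)) ≤
      216 * (d + 1) * (((subquarticEnds (Fin (3 * l - (d + 1))) (Fin (2 * l - (d + 1)))
        g K L g').ncard : ℝ) / ((3 * l - (d + 1)).factorial * 2 ^ (3 * l - (d + 1)))) := by
  obtain ⟨n, hn⟩ : ∃ n, n = 2 * l - (d + 1) := ⟨_, rfl⟩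
  obtain ⟨m, hm⟩ : ∃ m, m = 3 * l - (d + 1) := ⟨_, rfl⟩
  have hn' : 2 * l - d = n + 1 := by omega
  have hm' : 3 * l - d = m + 1 := by omega
  rw [hn', hm', ← hn, ← hm]
  have h1 := ncard_subquarticEnds_mul_le (E := Fin m) (V := Fin n) (g := g) (K := K) (L := L)
    (g' := g') (d := d) (by simp only [Fintype.card_fin]; omega)
  rw [Fintype.card_fin, Fintype.card_fin] at h1
  have h2 : (subquarticEnds (Fin (m + 1)) (Fin (n + 1)) g K L g').ncard * (n + 1 - 5 * d) ≤ _ :=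
    (Nat.mul_le_mul_right _ (ncard_subquarticEnds_le (finSuccEquiv n) (finSuccEquiv m).symm)).trans h1
  set A := (subquarticEnds (Fin m) (Fin n) g K L g').ncard
  set B := (subquarticEnds (Fin (m + 1)) (Fin (n + 1)) g K L g').ncard
  have h3 : B ≤ 224 * ((m + 1) * ((d + 1) * A)) := by
    -- Since 7(d + 1) ≤ 2l and n + 1 = 2l - d, at least a seventh of n + 1 half-edges are available
    -- for contraction. This gives 224 = 7 · 2 · 16.
    have h4 : n + 1 ≤ 7 * (n + 1 - 5 * d) := by omega
    have h5 : B * (n + 1) ≤ 224 * ((m + 1) * ((d + 1) * A)) * (n + 1) := by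
      calc B * (n + 1) ≤ B * (7 * (n + 1 - 5 * d)) := Nat.mul_le_mul_left _ h4
        _ = 7 * (B * (n + 1 - 5 * d)) := by ring
        _ ≤ 7 * (2 * (m + 1) * ((n + 1) * (16 * (d + 1) * A))) := Nat.mul_le_mul_left _ h2
        _ = _ := by ring
    exact Nat.le_of_mul_le_mul_right h5 (Nat.succ_pos n)
  have h4 : (B : ℝ) ≤ 224 * ((m + 1) * ((d + 1) * A)) := by exact_mod_cast h3
  have hf : (0 : ℝ) < m.factorial := Nat.cast_pos.2 (Nat.factorial_pos m)
  rw [Nat.factorial_succ, pow_succ, mul_div_assoc', div_le_div_iff₀ (by positivity) (by positivity)]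
  push_cast
  -- 432 = 2 · 216, where the 2 comes from the additional edge in 2^(m+1); 224 would already
  -- suffice.
  have h5 : (B : ℝ) ≤ 432 * ((m + 1) * ((d + 1) * A)) := by
    have : (0 : ℝ) ≤ (m + 1) * ((d + 1) * A) := by positivity
    linarith
  have h6 : (0 : ℝ) ≤ m.factorial * 2 ^ m := by positivity
  refine (mul_le_mul_of_nonneg_right h5 h6).trans (le_of_eq ?_)
  ring

theorem subquarticEnds_weight_ge {l d : ℕ} (hd : 7 * d ≤ 2 * l) :
    ((subquarticEnds (Fin (3 * l)) (Fin (2 * l)) g K L g').ncard : ℝ) /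
        ((3 * l).factorial * 2 ^ (3 * l)) ≤
      216 ^ d * d.factorial * (((subquarticEnds (Fin (3 * l - d)) (Fin (2 * l - d))
        g K L g').ncard : ℝ) / ((3 * l - d).factorial * 2 ^ (3 * l - d))) := by
  induction d with
  | zero => simp
  | succ d ih =>
    refine (ih (by omega)).trans ?_
    refine (mul_le_mul_of_nonneg_left (subquarticEnds_weight_succ_ge hd)
      (by positivity)).trans (le_of_eq ?_)
    rw [Nat.factorial_succ, pow_succ, ← mul_assoc]
    congr 1
    push_cast
    ring

theorem kernelEnds_weight_ge {l d : ℕ} (hd : (d : ℝ) ≤ 2 / 7 * l) :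
    1 / (216 ^ d * d.factorial) *
        (((kernelEnds (Fin (3 * l)) (Fin (2 * l)) g K L g').ncard : ℝ) /
          ((3 * l).factorial * 2 ^ (3 * l))) ≤
      ((kernelEnds (Fin (3 * l - d)) (Fin (2 * l - d)) g K L g').ncard : ℝ) /
        ((3 * l - d).factorial * 2 ^ (3 * l - d)) := by
  have hd' : 7 * d ≤ 2 * l := by
    have : (7 * d : ℝ) ≤ 2 * l := by linarith
    exact_mod_cast this
  -- With 2l vertices and 3l edges the degree sum is exactly three per vertex, so every kernel is
  -- cubic and the restriction to maximum degree four is void at the start of the iteration.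
  have hcubic : subquarticEnds (Fin (3 * l)) (Fin (2 * l)) g K L g' =
      kernelEnds (Fin (3 * l)) (Fin (2 * l)) g K L g' := by
    refine Set.Subset.antisymm (fun x hx => hx.1) fun x hx => ⟨hx, fun v => ?_⟩
    have h1 := sum_ncard_fiber x
    simp only [Fintype.card_fin] at h1
    have h2 : ∑ v, {h | x h = v}.ncard ≤ ∑ _v : Fin (2 * l), 3 := by
      rw [h1]
      simp only [Finset.sum_const, Finset.card_univ, Fintype.card_fin, smul_eq_mul]
      omega
    have h3 := (Finset.sum_eq_sum_iff_of_le fun v _ => hx.1 v).1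
      (le_antisymm (Finset.sum_le_sum fun v _ => hx.1 v) h2)
    have := h3 v (Finset.mem_univ v)
    omega
  have h1 := subquarticEnds_weight_ge (g := g) (K := K) (L := L) (g' := g') hd'
  rw [hcubic] at h1
  have hpos : (0 : ℝ) < 216 ^ d * d.factorial := by
    have : (0 : ℝ) < d.factorial := Nat.cast_pos.2 (Nat.factorial_pos d)
    positivity
  rw [one_div, inv_mul_le_iff₀ hpos]
  refine h1.trans (mul_le_mul_of_nonneg_left ?_ hpos.le)
  refine div_le_div_of_nonneg_right ?_ (by positivity)
  have hsub : subquarticEnds (Fin (3 * l - d)) (Fin (2 * l - d)) g K L g' ⊆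
      kernelEnds (Fin (3 * l - d)) (Fin (2 * l - d)) g K L g' := fun x hx => hx.1
  exact_mod_cast Set.ncard_le_ncard hsub

end HalfEdge

theorem lemma4p5 (g k l d : ℕ) (hl : 1 ≤ l) (hd : d ≤ 2 * l) :
    (kernelWeight g (2 * l - d) (3 * l - d)
        ≤ (6 : ℝ) ^ d / (d.factorial : ℝ) * kernelWeight g (2 * l) (3 * l) ∧
      kernelWeightWith g (2 * l - d) (3 * l - d) (HasComponents k)
        ≤ (6 : ℝ) ^ d / (d.factorial : ℝ) *
          kernelWeightWith g (2 * l) (3 * l) (HasComponents k) ∧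
      kernelWeightWith g (2 * l - d) (3 * l - d) (ComponentsOfSmallerGenus g)
        ≤ (6 : ℝ) ^ d / (d.factorial : ℝ) *
          kernelWeightWith g (2 * l) (3 * l) (ComponentsOfSmallerGenus g)) ∧
    ((d : ℝ) ≤ 2 / 7 * (l : ℝ) →
      1 / ((216 : ℝ) ^ d * (d.factorial : ℝ)) * kernelWeight g (2 * l) (3 * l)
        ≤ kernelWeight g (2 * l - d) (3 * l - d) ∧
      1 / ((216 : ℝ) ^ d * (d.factorial : ℝ)) *
          kernelWeightWith g (2 * l) (3 * l) (HasComponents k)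
        ≤ kernelWeightWith g (2 * l - d) (3 * l - d) (HasComponents k) ∧
      1 / ((216 : ℝ) ^ d * (d.factorial : ℝ)) *
          kernelWeightWith g (2 * l) (3 * l) (ComponentsOfSmallerGenus g)
        ≤ kernelWeightWith g (2 * l - d) (3 * l - d) (ComponentsOfSmallerGenus g)) := by
  simp only [HalfEdge.kernelWeight_eq, HalfEdge.kernelWeightWith_hasComponents_eq,
    HalfEdge.kernelWeightWith_componentsOfSmallerGenus_eq]
  exact ⟨⟨HalfEdge.kernelEnds_weight_le hl hd, HalfEdge.kernelEnds_weight_le hl hd,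
    HalfEdge.kernelEnds_weight_le hl hd⟩, fun hd => ⟨HalfEdge.kernelEnds_weight_ge hd,
    HalfEdge.kernelEnds_weight_ge hd, HalfEdge.kernelEnds_weight_ge hd⟩⟩
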